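/- Let $X$ be a compact connected complex surface with a Kähler form $\omega$. Let $(\rho_0,\rho_1,\rho_2)$ be nonzero complex numbers with $\mathrm{Im}(\rho_j/\rho_{j+1})>0$ for $j=0,1$, and let $u_1,u_2$ be closed real forms on $X$ of type $(1,1)$ and $(2,2)$, with classes $U_1,U_2$. For a coherent sheaf $F$ on $X$, with Chern character defined through resolutions by holomorphic vector bundles, put $$Z_X(F)=\bigl(\rho_0U_2+\rho_1U_1.[\omega]+\rho_2[\omega]^2\bigr)\,\mathrm{rk}(F)+\bigl(\rho_0U_1+\rho_1[\omega]\bigr).\mathrm{ch}_1(F)+\rho_0\,\mathrm{ch}_2(F)\in\mathbb{C},$$ where classes of top degree are integrated over $X$. Let $E$ be a holomorphic vector bundle on $X$ with $Z_X(E)\neq 0$, write $Z_X(E)=|Z_X(E)|e^{i\vartheta_E}$, and put $$\alpha=\tfrac12\,\mathrm{Im}\bigl(e^{-i\vartheta_E}\rho_0\bigr),\qquad \beta=\mathrm{Im}\bigl(e^{-i\vartheta_E}(\rho_0u_1+\rho_1\omega)\bigr).$$ If $\alpha\neq0$, let $\vartheta=[\beta/2\alpha]\in H^{2}(X,\mathbb{R})$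 and, for a coherent sheaf $F$ of positive rank, $$\mu_{MA,\vartheta}(F)=\frac{\mathrm{ch}_2(F)+\mathrm{ch}_1(F).\vartheta}{\mathrm{rk}(F)}.$$ (1) If $\alpha\neq0$, then for every coherent subsheaf $S\subset E$ of positive rank $$\mathrm{Im}\bigl(Z_X(S)\,\overline{Z_X(E)}\bigr)=2\alpha\,\mathrm{rk}(S)\,|Z_X(E)|\,\bigl(\mu_{MA,\vartheta}(S)-\mu_{MA,\vartheta}(E)\bigr).$$ (2) If $\alpha>0$, then $E$ is $Z$-stable if and only if $E$ is $\vartheta$-Monge–Ampère stable. Here $E$ is $Z$-stable if $\mathrm{Im}\bigl(Z_X(Q)/Z_X(E)\bigr)>0$ for every coherent torsion-free quotient $Q$ of $E$ with $0<\mathrm{rk}(Q)<\mathrm{rk}(E)$, and $E$ is $\vartheta$-Monge–Ampère stable if $\mu_{MA,\vartheta}(S)<\mu_{MA,\vartheta}(E)$ for every coherent subsheaf $S\subset E$ with $E/S$ torsion-free (a saturated subsheaf) and $0<\mathrm{rk}(S)<\mathrm{rk}(E)$. -/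

import Mathlib

open CategoryTheory Opposite TopologicalSpace MeasureTheory
open scoped Manifold ContDiff ComplexOrder

namespace KahlerSurface

noncomputable section

set_option linter.unusedSectionVars false
set_option linter.unusedSimpArgs false
set_option linter.style.haveILetI false

/-- The model space of a complex surface. -/
abbrev C2 : Type := ℂ × ℂ
/-- Real alternating `k`-forms on the real vector space underlying `ℂ²`. -/
abbrev Alt (k : ℕ) : Type := C2 [⋀^Fin k]→L[ℝ] ℝ

section Linear
theorem alt_add_left (a : Alt 2) (x y z : C2) : a ![x + y, z] = a ![x, z] + a ![y, z] :=
  a.vecCons_add ![z] x y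

theorem alt_smul_left (a : Alt 2) (c : ℝ) (x z : C2) : a ![c • x, z] = c * a ![x, z] :=
  a.vecCons_smul ![z] c x

theorem alt_swap (a : Alt 2) (x z : C2) : a ![z, x] = - a ![x, z] := by
  have h := a.toAlternatingMap.map_swap ![x, z] (i := 0) (j := 1) (by decide)
  have h2 : (![x, z] ∘ Equiv.swap (0 : Fin 2) 1) = ![z, x] := by
    funext i; fin_cases i <;> rfl
  rw [h2] at h
  exact h

theorem alt_add_right (a : Alt 2) (x y z : C2) : a ![z, x + y] = a ![z, x] + a ![z, y] := by
  rw [alt_swap, alt_add_left, alt_swap a x z, alt_swap a y z]; ring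

theorem alt_smul_right (a : Alt 2) (c : ℝ) (x z : C2) : a ![z, c • x] = c * a ![z, x] := by
  rw [alt_swap, alt_smul_left, alt_swap a x z]; ring

theorem alt_self (a : Alt 2) (x : C2) : a ![x, x] = 0 := by
  have := alt_swap a x x; linarith

theorem fin_four (i : Fin 4) : i = 0 ∨ i = 1 ∨ i = 2 ∨ i = 3 := by
  revert i; decide

/-- The wedge product of two real 2-forms on `ℂ²`. -/
def wedge (a b : Alt 2) : Alt 4 where
  toFun v := a ![v 0, v 1] * b ![v 2, v 3] - a ![v 0, v 2] * b ![v 1, v 3]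
    + a ![v 0, v 3] * b ![v 1, v 2] + a ![v 1, v 2] * b ![v 0, v 3]
    - a ![v 1, v 3] * b ![v 0, v 2] + a ![v 2, v 3] * b ![v 0, v 1]
  map_update_add' := by
    intro inst v i x y
    have e (j : Fin 4) (h : j.val ≠ i.val) (z : C2) : Function.update v i z j = v j :=
      Function.update_of_ne (fun hj => h (congrArg _ hj)) z v
    obtain rfl | rfl | rfl | rfl := fin_four i
    · rw [e 1 (by decide), e 1 (by decide), e 1 (by decide), e 2 (by decide), e 2 (by decide),
        e 2 (by decide), e 3 (by decide), e 3 (by decide), e 3 (by decide)]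
      simp only [Function.update_self, alt_add_left, alt_add_right]; ring
    · rw [e 0 (by decide), e 0 (by decide), e 0 (by decide), e 2 (by decide), e 2 (by decide),
        e 2 (by decide), e 3 (by decide), e 3 (by decide), e 3 (by decide)]
      simp only [Function.update_self, alt_add_left, alt_add_right]; ring
    · rw [e 0 (by decide), e 0 (by decide), e 0 (by decide), e 1 (by decide), e 1 (by decide),
        e 1 (by decide), e 3 (by decide), e 3 (by decide), e 3 (by decide)]
      simp only [Function.update_self, alt_add_left, alt_add_right]; ring
    · rw [e 0 (by decide), e 0 (by decide), e 0 (by decide), e 1 (by decide), e 1 (by decide),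
        e 1 (by decide), e 2 (by decide), e 2 (by decide), e 2 (by decide)]
      simp only [Function.update_self, alt_add_left, alt_add_right]; ring
  map_update_smul' := by
    intro inst v i c x
    have e (j : Fin 4) (h : j.val ≠ i.val) (z : C2) : Function.update v i z j = v j :=
      Function.update_of_ne (fun hj => h (congrArg _ hj)) z v
    obtain rfl | rfl | rfl | rfl := fin_four i
    · rw [e 1 (by decide), e 1 (by decide), e 2 (by decide), e 2 (by decide), e 3 (by decide),
        e 3 (by decide)]
      simp only [Function.update_self, alt_smul_left, alt_smul_right, smul_eq_mul]; ring
    · rw [e 0 (by decide), e 0 (by decide), e 2 (by decide), e 2 (by decide), e 3 (by decide),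
        e 3 (by decide)]
      simp only [Function.update_self, alt_smul_left, alt_smul_right, smul_eq_mul]; ring
    · rw [e 0 (by decide), e 0 (by decide), e 1 (by decide), e 1 (by decide), e 3 (by decide),
        e 3 (by decide)]
      simp only [Function.update_self, alt_smul_left, alt_smul_right, smul_eq_mul]; ring
    · rw [e 0 (by decide), e 0 (by decide), e 1 (by decide), e 1 (by decide), e 2 (by decide),
        e 2 (by decide)]
      simp only [Function.update_self, alt_smul_left, alt_smul_right, smul_eq_mul]; ring
  cont := by
    have h (c : Alt 2) (i j : Fin 4) : Continuous fun v : Fin 4 → C2 => c ![v i, v j] := by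
      refine c.cont.comp (continuous_pi fun k => ?_)
      obtain rfl | rfl : k = 0 ∨ k = 1 := by revert k; decide
      · exact continuous_apply i
      · exact continuous_apply j
    exact ((((((h _ _ _).mul (h _ _ _)).sub ((h _ _ _).mul (h _ _ _))).add
      ((h _ _ _).mul (h _ _ _))).add ((h _ _ _).mul (h _ _ _))).sub
      ((h _ _ _).mul (h _ _ _))).add ((h _ _ _).mul (h _ _ _))
  map_eq_zero_of_eq' := by
    intro v i j h hij
    have key (c : Alt 2) (k l : Fin 4) : c ![v l, v k] = - c ![v k, v l] := alt_swap c _ _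
    have self (c : Alt 2) (k l : Fin 4) (h : v k = v l) : c ![v k, v l] = 0 := by
      rw [h, alt_self]
    obtain rfl | rfl | rfl | rfl := fin_four i <;>
      obtain rfl | rfl | rfl | rfl := fin_four j <;>
      first
      | exact absurd rfl hij
      | (rw [self a _ _ h, self b _ _ h, h]; ring1)
      | (rw [self a _ _ h, self b _ _ h, h, key a 1 2, key b 1 2]; ring1)
      | (rw [self a _ _ h, self b _ _ h, h, key a 1 3, key b 1 3, key a 2 3, key b 2 3]; ring1)
      | (rw [self a _ _ h, self b _ _ h, h, key a 2 3, key b 2 3]; ring1)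
      | (rw [self a _ _ h.symm, self b _ _ h.symm, h]; ring1)
      | (rw [self a _ _ h.symm, self b _ _ h.symm, ← h, key a 1 2, key b 1 2]; ring1)
      | (rw [self a _ _ h.symm, self b _ _ h.symm, ← h, key a 1 3, key b 1 3, key a 2 3,
          key b 2 3]; ring1)
      | (rw [self a _ _ h.symm, self b _ _ h.symm, ← h, key a 2 3, key b 2 3]; ring1)

theorem wedge_apply (a b : Alt 2) (v : Fin 4 → C2) : wedge a b v =
    a ![v 0, v 1] * b ![v 2, v 3] - a ![v 0, v 2] * b ![v 1, v 3]
    + a ![v 0, v 3] * b ![v 1, v 2] + a ![v 1, v 2] * b ![v 0, v 3]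
    - a ![v 1, v 3] * b ![v 0, v 2] + a ![v 2, v 3] * b ![v 0, v 1] := rfl

/-- The positively oriented real frame `∂/∂x₁, ∂/∂y₁, ∂/∂x₂, ∂/∂y₂` of `ℂ²`. -/
def frame : Fin 4 → C2 := ![(1, 0), (Complex.I, 0), (0, 1), (0, Complex.I)]

theorem wedge_add_left (a a' b : Alt 2) : wedge (a + a') b = wedge a b + wedge a' b := by
  ext v; simp [wedge_apply]; ring
theorem wedge_smul_left (c : ℝ) (a b : Alt 2) : wedge (c • a) b = c • wedge a b := by
  ext v; simp [wedge_apply]; ring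
theorem wedge_comm (a b : Alt 2) : wedge a b = wedge b a := by
  ext v; simp [wedge_apply]; ring
theorem wedge_comp (a b : Alt 2) (L : C2 →L[ℝ] C2) :
    wedge (a.compContinuousLinearMap L) (b.compContinuousLinearMap L)
      = (wedge a b).compContinuousLinearMap L := by
  have h (x y : C2) : (⇑L ∘ ![x, y]) = ![L x, L y] := by
    funext i; fin_cases i <;> rfl
  ext v; simp [wedge_apply, h]

/-- The vectors of `frame` as a real basis of `ℂ²`. -/
def frameBasis : Module.Basis (Fin 4) ℝ C2 :=
  (Complex.basisOneI.prod Complex.basisOneI).reindex finSumFinEquiv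

theorem frameBasis_coe : ⇑frameBasis = frame := by
  have h0 : finSumFinEquiv.symm (0 : Fin (2 + 2)) = Sum.inl 0 := rfl
  have h1 : finSumFinEquiv.symm (1 : Fin (2 + 2)) = Sum.inl 1 := rfl
  have h2 : finSumFinEquiv.symm (2 : Fin (2 + 2)) = Sum.inr 0 := rfl
  have h3 : finSumFinEquiv.symm (3 : Fin (2 + 2)) = Sum.inr 1 := rfl
  funext i
  rw [frameBasis, Module.Basis.reindex_apply]
  obtain rfl | rfl | rfl | rfl := fin_four i
  · rw [h0]; simp [frame]
  · rw [h1]; simp [frame]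
  · rw [h2]; simp [frame]
  · rw [h3]; simp [frame]

theorem alt_comp_frame (w : Alt 4) (L : C2 →L[ℝ] C2) :
    w.compContinuousLinearMap L frame = L.det * w frame := by
  have h := AlternatingMap.eq_smul_basis_det frameBasis w.toAlternatingMap
  have h2 : w (L ∘ frame) = w frame * frameBasis.det (L ∘ frame) := by
    have := congrArg (fun f => f (L ∘ frame)) h
    simpa [frameBasis_coe] using this
  have h3 : frameBasis.det (L ∘ frame) = L.det := by
    rw [← frameBasis_coe]
    have := frameBasis.det_comp (L : C2 →ₗ[ℝ] C2) frameBasis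
    rw [frameBasis.det_self] at this
    simpa using this
  simp only [ContinuousAlternatingMap.compContinuousLinearMap_apply]
  rw [h2, h3, mul_comm]

theorem det_nonneg (L : C2 →L[ℂ] C2) : 0 ≤ (L.restrictScalars ℝ).det := by
  have : (L.restrictScalars ℝ).det = Algebra.norm ℝ (LinearMap.det (L : C2 →ₗ[ℂ] C2)) := by
    rw [← LinearMap.det_restrictScalars]; rfl
  rw [this, Algebra.norm_complex_apply]
  exact Complex.normSq_nonneg _
end Linear

section Local

instance : (volume : Measure C2).IsAddHaarMeasure :=
  inferInstanceAs ((volume : Measure ℂ).prod (volume : Measure ℂ)).IsAddHaarMeasure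

theorem integral_deriv_eq_zero {T K : Set C2} (hT : IsOpen T) (hK : IsCompact K) (hKT : K ⊆ T)
    {F : C2 → ℝ} (hF : ContDiffOn ℝ 1 F T) (h0 : ∀ y ∈ T, y ∉ K → F y = 0) (v : C2) :
    ∫ y in T, fderiv ℝ F y v = 0 := by
  set G : C2 → ℝ := T.indicator F with hG
  have hGT : ∀ y ∈ T, G =ᶠ[nhds y] F := fun y hy =>
    Filter.eventuallyEq_of_mem (hT.mem_nhds hy) (fun z hz => Set.indicator_of_mem hz F)
  have hG0 : ∀ y, y ∉ K → G y = 0 := by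
    intro y hy
    by_cases hyT : y ∈ T
    · rw [hG, Set.indicator_of_mem hyT]; exact h0 y hyT hy
    · exact Set.indicator_of_notMem hyT F
  have hGK : ∀ y, y ∉ K → G =ᶠ[nhds y] 0 := fun y hy =>
    Filter.eventuallyEq_of_mem (hK.isClosed.isOpen_compl.mem_nhds hy) (fun z hz => hG0 z hz)
  have hGs : ContDiff ℝ 1 G := by
    rw [contDiff_iff_contDiffAt]
    intro y
    by_cases hy : y ∈ K
    · exact (hF.contDiffAt (hT.mem_nhds (hKT hy))).congr_of_eventuallyEq (hGT y (hKT hy))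
    · exact contDiffAt_const.congr_of_eventuallyEq (hGK y hy)
  have hcs : HasCompactSupport G := HasCompactSupport.intro hK hG0
  have hcont : Continuous fun y => fderiv ℝ G y v :=
    (hGs.continuous_fderiv one_ne_zero).clm_apply continuous_const
  have hcs' : HasCompactSupport fun y => fderiv ℝ G y v := hcs.fderiv_apply ℝ v
  have h1 : ∫ y, fderiv ℝ G y v = 0 := by
    have := integral_mul_fderiv_eq_neg_fderiv_mul_of_integrable (μ := (volume : Measure C2))
      (f := fun _ : C2 => (1 : ℝ)) (g := G) (v := v) (by simp)
      (by simpa using hcont.integrable_of_hasCompactSupport hcs')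
      (by simpa using hGs.continuous.integrable_of_hasCompactSupport hcs)
      (fun _ _ => differentiableAt_const _)
      (fun y _ => hGs.differentiable one_ne_zero y)
    simpa using this
  have h2 : ∫ y in T, fderiv ℝ G y v = ∫ y, fderiv ℝ G y v := by
    refine setIntegral_eq_integral_of_forall_compl_eq_zero fun y hy => ?_
    rw [(hGK y fun h => hy (hKT h)).fderiv_eq]
    simp
  rw [← h1, ← h2]
  refine setIntegral_congr_fun hT.measurableSet fun y hy => ?_
  simp only [(hGT y hy).fderiv_eq]

theorem extDeriv_one {θ : C2 → Alt 1} {y : C2} (h : DifferentiableAt ℝ θ y) (u v : C2) :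
    extDeriv θ y ![u, v]
      = fderiv ℝ (fun z => θ z ![v]) y u - fderiv ℝ (fun z => θ z ![u]) y v := by
  refine (extDeriv_apply h _).trans ((Fin.sum_univ_two _).trans ?_)
  have e0 : Fin.removeNth (0 : Fin 2) ![u, v] = ![v] := by
    funext i; fin_cases i; rfl
  have e1 : Fin.removeNth (1 : Fin 2) ![u, v] = ![u] := by
    funext i; fin_cases i; rfl
  rw [e0, e1]
  simp [sub_eq_add_neg]

theorem extDeriv_two {b : C2 → Alt 2} {y : C2} (h : DifferentiableAt ℝ b y) (u v w : C2) :
    extDeriv b y ![u, v, w]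
      = fderiv ℝ (fun z => b z ![v, w]) y u - fderiv ℝ (fun z => b z ![u, w]) y v
        + fderiv ℝ (fun z => b z ![u, v]) y w := by
  refine (extDeriv_apply h _).trans ((Fin.sum_univ_three _).trans ?_)
  have e0 : Fin.removeNth (0 : Fin 3) ![u, v, w] = ![v, w] := by
    funext i; fin_cases i <;> rfl
  have e1 : Fin.removeNth (1 : Fin 3) ![u, v, w] = ![u, w] := by
    funext i; fin_cases i <;> rfl
  have e2 : Fin.removeNth (2 : Fin 3) ![u, v, w] = ![u, v] := by
    funext i; fin_cases i <;> rfl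
  rw [e0, e1, e2]
  simp [sub_eq_add_neg]

theorem contDiffOn_eval {k : ℕ} {T : Set C2} {n : WithTop ℕ∞} {w : C2 → Alt k}
    (hw : ContDiffOn ℝ n w T) (v : Fin k → C2) : ContDiffOn ℝ n (fun y => w y v) T :=
  (ContinuousAlternatingMap.apply ℝ C2 ℝ v).contDiff.comp_contDiffOn hw

theorem local_stokes {T K : Set C2} (hT : IsOpen T) (hK : IsCompact K) (hKT : K ⊆ T)
    {θ : C2 → Alt 1} {b : C2 → Alt 2} (hθ : ContDiffOn ℝ ∞ θ T) (hb : ContDiffOn ℝ ∞ b T)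
    (h0 : ∀ y ∈ T, y ∉ K → θ y = 0) (hcl : ∀ y ∈ T, extDeriv b y = 0) :
    ∫ y in T, wedge (extDeriv θ y) (b y) frame = 0 := by
  obtain ⟨e0, he0⟩ : ∃ e, e = frame 0 := ⟨_, rfl⟩
  obtain ⟨e1, he1⟩ : ∃ e, e = frame 1 := ⟨_, rfl⟩
  obtain ⟨e2, he2⟩ : ∃ e, e = frame 2 := ⟨_, rfl⟩
  obtain ⟨e3, he3⟩ : ∃ e, e = frame 3 := ⟨_, rfl⟩
  have hA (e : C2) : ContDiffOn ℝ ∞ (fun y => θ y ![e]) T := contDiffOn_eval hθ _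
  have hB (e f : C2) : ContDiffOn ℝ ∞ (fun y => b y ![e, f]) T := contDiffOn_eval hb _
  set A : C2 → C2 → ℝ := fun e y => θ y ![e] with hAdef
  set B : C2 → C2 → C2 → ℝ := fun e f y => b y ![e, f] with hBdef
  have hz (e : C2) (y : C2) (hy : y ∈ T) (hyK : y ∉ K) : A e y = 0 := by
    simp [hAdef, h0 y hy hyK]
  let F0 : C2 → ℝ := fun y => A e1 y * B e2 e3 y - A e2 y * B e1 e3 y + A e3 y * B e1 e2 y
  let F1 : C2 → ℝ := fun y => A e2 y * B e0 e3 y - A e0 y * B e2 e3 y - A e3 y * B e0 e2 y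
  let F2 : C2 → ℝ := fun y => A e0 y * B e1 e3 y - A e1 y * B e0 e3 y + A e3 y * B e0 e1 y
  let F3 : C2 → ℝ := fun y => A e1 y * B e0 e2 y - A e0 y * B e1 e2 y - A e2 y * B e0 e1 y
  have s0 : ContDiffOn ℝ ∞ F0 T := (((hA e1).mul (hB e2 e3)).sub ((hA e2).mul (hB e1 e3))).add
    ((hA e3).mul (hB e1 e2))
  have s1 : ContDiffOn ℝ ∞ F1 T := (((hA e2).mul (hB e0 e3)).sub ((hA e0).mul (hB e2 e3))).sub
    ((hA e3).mul (hB e0 e2))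
  have s2 : ContDiffOn ℝ ∞ F2 T := (((hA e0).mul (hB e1 e3)).sub ((hA e1).mul (hB e0 e3))).add
    ((hA e3).mul (hB e0 e1))
  have s3 : ContDiffOn ℝ ∞ F3 T := (((hA e1).mul (hB e0 e2)).sub ((hA e0).mul (hB e1 e2))).sub
    ((hA e2).mul (hB e0 e1))
  have key : ∀ y ∈ T, wedge (extDeriv θ y) (b y) frame
      = fderiv ℝ F0 y e0 + fderiv ℝ F1 y e1 + fderiv ℝ F2 y e2 + fderiv ℝ F3 y e3 := by
    intro y hy
    have hn := hT.mem_nhds hy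
    have dθ : DifferentiableAt ℝ θ y := (hθ.contDiffAt hn).differentiableAt (by simp)
    have db : DifferentiableAt ℝ b y := (hb.contDiffAt hn).differentiableAt (by simp)
    have dA (e : C2) : DifferentiableAt ℝ (A e) y :=
      ((hA e).contDiffAt hn).differentiableAt (by simp)
    have dB (e f : C2) : DifferentiableAt ℝ (B e f) y :=
      ((hB e f).contDiffAt hn).differentiableAt (by simp)
    have c (u v w : C2) : fderiv ℝ (B v w) y u - fderiv ℝ (B u w) y v
        + fderiv ℝ (B u v) y w = 0 := by
      rw [← extDeriv_two db, hcl y hy]; rfl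
    have m (e f g u : C2) : fderiv ℝ (fun z => A e z * B f g z) y u
        = A e y * fderiv ℝ (B f g) y u + B f g y * fderiv ℝ (A e) y u := by
      rw [fderiv_fun_mul (dA e) (dB f g)]; simp
    have dm (e f g : C2) : DifferentiableAt ℝ (fun z => A e z * B f g z) y :=
      (dA e).mul (dB f g)
    have p3 {P Q R : C2 → ℝ} (hP : DifferentiableAt ℝ P y) (hQ : DifferentiableAt ℝ Q y)
        (hR : DifferentiableAt ℝ R y) (u : C2) : fderiv ℝ (fun z => P z - Q z + R z) y u
          = fderiv ℝ P y u - fderiv ℝ Q y u + fderiv ℝ R y u := by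
      exact DFunLike.congr_fun ((hP.hasFDerivAt.sub hQ.hasFDerivAt).add hR.hasFDerivAt).fderiv u
    have m3 {P Q R : C2 → ℝ} (hP : DifferentiableAt ℝ P y) (hQ : DifferentiableAt ℝ Q y)
        (hR : DifferentiableAt ℝ R y) (u : C2) : fderiv ℝ (fun z => P z - Q z - R z) y u
          = fderiv ℝ P y u - fderiv ℝ Q y u - fderiv ℝ R y u := by
      exact DFunLike.congr_fun ((hP.hasFDerivAt.sub hQ.hasFDerivAt).sub hR.hasFDerivAt).fderiv u
    have f0 : fderiv ℝ F0 y e0 = _ := p3 (dm e1 e2 e3) (dm e2 e1 e3) (dm e3 e1 e2) e0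
    have f1 : fderiv ℝ F1 y e1 = _ := m3 (dm e2 e0 e3) (dm e0 e2 e3) (dm e3 e0 e2) e1
    have f2 : fderiv ℝ F2 y e2 = _ := p3 (dm e0 e1 e3) (dm e1 e0 e3) (dm e3 e0 e1) e2
    have f3 : fderiv ℝ F3 y e3 = _ := m3 (dm e1 e0 e2) (dm e0 e1 e2) (dm e2 e0 e1) e3
    rw [m, m, m] at f0 f1 f2 f3
    rw [f0, f1, f2, f3, wedge_apply, ← he0, ← he1, ← he2, ← he3]
    simp only [extDeriv_one dθ]
    change (fderiv ℝ (A e1) y e0 - fderiv ℝ (A e0) y e1) * B e2 e3 y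
      - (fderiv ℝ (A e2) y e0 - fderiv ℝ (A e0) y e2) * B e1 e3 y
      + (fderiv ℝ (A e3) y e0 - fderiv ℝ (A e0) y e3) * B e1 e2 y
      + (fderiv ℝ (A e2) y e1 - fderiv ℝ (A e1) y e2) * B e0 e3 y
      - (fderiv ℝ (A e3) y e1 - fderiv ℝ (A e1) y e3) * B e0 e2 y
      + (fderiv ℝ (A e3) y e2 - fderiv ℝ (A e2) y e3) * B e0 e1 y = _
    linear_combination A e0 y * c e1 e2 e3 - A e1 y * c e0 e2 e3 + A e2 y * c e0 e1 e3
      - A e3 y * c e0 e1 e2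
  have int {F : C2 → ℝ} (hF : ContDiffOn ℝ ∞ F T) (hF0 : ∀ y ∈ T, y ∉ K → F y = 0) (v : C2) :
      IntegrableOn (fun y => fderiv ℝ F y v) T := by
    have hc : ContinuousOn (fun y => fderiv ℝ F y v) T :=
      ((hF.continuousOn_fderiv_of_isOpen hT (by simp))).clm_apply continuousOn_const
    refine ((hc.mono hKT).integrableOn_compact hK).of_forall_sdiff_eq_zero hT.measurableSet ?_
    intro y hy
    have : F =ᶠ[nhds y] 0 := Filter.eventuallyEq_of_mem
      ((hT.inter hK.isClosed.isOpen_compl).mem_nhds ⟨hy.1, hy.2⟩) fun z hz => hF0 z hz.1 hz.2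
    rw [this.fderiv_eq]; simp
  have z0 : ∀ y ∈ T, y ∉ K → F0 y = 0 := fun y hy hyK => by simp [F0, hz _ y hy hyK]
  have z1 : ∀ y ∈ T, y ∉ K → F1 y = 0 := fun y hy hyK => by simp [F1, hz _ y hy hyK]
  have z2 : ∀ y ∈ T, y ∉ K → F2 y = 0 := fun y hy hyK => by simp [F2, hz _ y hy hyK]
  have z3 : ∀ y ∈ T, y ∉ K → F3 y = 0 := fun y hy hyK => by simp [F3, hz _ y hy hyK]
  have i01 : IntegrableOn (fun y => fderiv ℝ F0 y e0 + fderiv ℝ F1 y e1) T :=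
    (int s0 z0 e0).add (int s1 z1 e1)
  have i012 : IntegrableOn (fun y => fderiv ℝ F0 y e0 + fderiv ℝ F1 y e1 + fderiv ℝ F2 y e2) T :=
    i01.add (int s2 z2 e2)
  rw [setIntegral_congr_fun hT.measurableSet key, integral_add i012 (int s3 z3 e3),
    integral_add i01 (int s2 z2 e2), integral_add (int s0 z0 e0) (int s1 z1 e1),
    integral_deriv_eq_zero hT hK hKT (s0.of_le (by simp)) z0,
    integral_deriv_eq_zero hT hK hKT (s1.of_le (by simp)) z1,
    integral_deriv_eq_zero hT hK hKT (s2.of_le (by simp)) z2,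
    integral_deriv_eq_zero hT hK hKT (s3.of_le (by simp)) z3]
  simp
end Local

section Forms
variable (X : Type) [TopologicalSpace X] [ChartedSpace C2 X]

variable {X} in
/-- The change of coordinates from the chart at `p` to the chart at `q`. -/
def trans (p q : X) (y : C2) : C2 := chartAt C2 q ((chartAt C2 p).symm y)

variable {X} in
/-- The image, in the chart at `p`, of the overlap of the charts at `p` and `q`. -/
def overlap (p q : X) : Set C2 :=
  (chartAt C2 p).target ∩ (chartAt C2 p).symm ⁻¹' (chartAt C2 q).source

/-- Smooth real differential `k`-forms on `X`, given by their expressions in the charts `chartAt C2 p`;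
only the values of `w p` on the target of the chart matter. -/
def DiffForm (k : ℕ) : Submodule ℝ (X → C2 → Alt k) where
  carrier := {w | (∀ p, ContDiffOn ℝ ∞ (w p) (chartAt C2 p).target) ∧
    ∀ p q, ∀ y ∈ overlap p q,
      w p y = (w q (trans p q y)).compContinuousLinearMap (fderiv ℝ (trans p q) y)}
  add_mem' := by
    rintro a b ⟨ha, ha'⟩ ⟨hb, hb'⟩
    refine ⟨fun p => (ha p).add (hb p), fun p q y hy => ?_⟩
    simp only [Pi.add_apply, ha' p q y hy, hb' p q y hy]; rfl
  zero_mem' := ⟨fun p => contDiffOn_const, fun p q y _ => rfl⟩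
  smul_mem' := by
    rintro c a ⟨ha, ha'⟩
    refine ⟨fun p => (ha p).const_smul c, fun p q y hy => ?_⟩
    simp only [Pi.smul_apply, ha' p q y hy]; rfl

variable {X} in
theorem form_differentiableAt {k : ℕ} {w : X → C2 → Alt k} (hw : w ∈ DiffForm X k) (p : X)
    {y : C2} (hy : y ∈ (chartAt C2 p).target) : DifferentiableAt ℝ (w p) y :=
  ((hw.1 p).contDiffAt ((chartAt C2 p).open_target.mem_nhds hy)).differentiableAt (by simp)

/-- Closed forms: `d w = 0`. -/
def closedForms (k : ℕ) : Submodule ℝ (X → C2 → Alt k) where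
  carrier := {w | w ∈ DiffForm X k ∧ ∀ p, ∀ y ∈ (chartAt C2 p).target, extDeriv (w p) y = 0}
  add_mem' := by
    rintro a b ⟨ha', ha⟩ ⟨hb', hb⟩
    refine ⟨add_mem ha' hb', fun p y hy => ?_⟩
    exact (extDeriv_add (form_differentiableAt ha' p hy) (form_differentiableAt hb' p hy)).trans
      (by rw [ha p y hy, hb p y hy, add_zero])
  zero_mem' := by
    refine ⟨zero_mem _, fun p y _ => ?_⟩
    have := extDeriv_smul (0 : ℝ) (fun _ : C2 => (0 : Alt k)) (x := y)
    simpa using this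
  smul_mem' := by
    rintro c a ⟨ha', ha⟩
    refine ⟨Submodule.smul_mem _ c ha', fun p y hy => ?_⟩
    exact (extDeriv_smul c (a p)).trans (by rw [ha p y hy, smul_zero])

/-- Exact 2-forms, as a subspace of the closed forms. -/
def exactForms : Submodule ℝ (closedForms X 2) where
  carrier := {w | ∃ η ∈ DiffForm X 1, ∀ p, ∀ y ∈ (chartAt C2 p).target,
    w.1 p y = extDeriv (η p) y}
  add_mem' := by
    rintro a b ⟨η, hη', hη⟩ ⟨ξ, hξ', hξ⟩
    refine ⟨η + ξ, add_mem hη' hξ', fun p y hy => ?_⟩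
    refine Eq.trans ?_
      (extDeriv_add (form_differentiableAt hη' p hy) (form_differentiableAt hξ' p hy)).symm
    rw [← hη p y hy, ← hξ p y hy]; rfl
  zero_mem' := by
    refine ⟨0, zero_mem _, fun p y hy => ?_⟩
    have := extDeriv_smul (0 : ℝ) (fun _ : C2 => (0 : Alt 1)) (x := y)
    exact (by simpa using this : extDeriv (0 : C2 → Alt 1) y = 0).symm
  smul_mem' := by
    rintro c a ⟨η, hη', hη⟩
    refine ⟨c • η, Submodule.smul_mem _ c hη', fun p y hy => ?_⟩
    refine Eq.trans ?_ (extDeriv_smul c (η p)).symm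
    rw [← hη p y hy]; rfl

instance : AddCommGroup (closedForms X 2) := Submodule.addCommGroup _

/-- The second de Rham cohomology group `H²(X, ℝ)`. -/
abbrev H2 : Type := closedForms X 2 ⧸ exactForms X

variable {X}

theorem overlap_eq (p q : X) :
    overlap p q = ((chartAt C2 p).symm.trans (chartAt C2 q)).source := by
  ext y; simp [overlap]

theorem isOpen_overlap (p q : X) : IsOpen (overlap p q) := by
  rw [overlap_eq]; exact OpenPartialHomeomorph.open_source _

theorem trans_mem {p q : X} {y : C2} (hy : y ∈ overlap p q) : trans p q y ∈ overlap q p := by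
  refine ⟨(chartAt C2 q).map_source hy.2, ?_⟩
  simp only [Set.mem_preimage, trans, (chartAt C2 q).left_inv hy.2]
  exact (chartAt C2 p).map_target hy.1

theorem trans_trans {p q : X} {y : C2} (hy : y ∈ overlap p q) :
    trans q p (trans p q y) = y := by
  simp only [trans, (chartAt C2 q).left_inv hy.2]
  exact (chartAt C2 p).right_inv hy.1

theorem symm_trans {p q : X} {y : C2} (hy : y ∈ overlap p q) :
    (chartAt C2 q).symm (trans p q y) = (chartAt C2 p).symm y := by
  simp only [trans, (chartAt C2 q).left_inv hy.2]

variable [IsManifold 𝓘(ℂ, C2) ∞ X]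

theorem contDiffOn_trans_complex (p q : X) : ContDiffOn ℂ ∞ (trans p q) (overlap p q) := by
  have h := HasGroupoid.compatible (G := contDiffGroupoid ∞ 𝓘(ℂ, C2))
    (chart_mem_atlas C2 p) (chart_mem_atlas C2 q)
  rw [contDiffGroupoid, mem_groupoid_of_pregroupoid] at h
  have h1 := h.1
  rw [overlap_eq]
  have h2 : trans p q = fun x => chartAt C2 q ((chartAt C2 p).symm x) := rfl
  rw [h2]
  simpa [contDiffPregroupoid, Function.comp_def] using h1

theorem contDiffOn_trans (p q : X) : ContDiffOn ℝ ∞ (trans p q) (overlap p q) :=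
  (contDiffOn_trans_complex p q).restrict_scalars ℝ

theorem det_trans_nonneg {p q : X} {y : C2} (hy : y ∈ overlap p q) :
    0 ≤ (fderiv ℝ (trans p q) y).det := by
  have h : DifferentiableAt ℂ (trans p q) y :=
    ((contDiffOn_trans_complex p q).contDiffAt ((isOpen_overlap p q).mem_nhds hy)).differentiableAt
      (by simp)
  rw [h.fderiv_restrictScalars ℝ]
  exact det_nonneg _

variable (X) in
/-- The smooth real manifold underlying a complex manifold. -/
theorem isManifold_real : IsManifold 𝓘(ℝ, C2) ∞ X := by
  refine isManifold_of_contDiffOn _ _ _ fun e e' he he' => ?_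
  have h := HasGroupoid.compatible (G := contDiffGroupoid ∞ 𝓘(ℂ, C2)) he he'
  rw [contDiffGroupoid, mem_groupoid_of_pregroupoid] at h
  have h1 : ContDiffOn ℂ ∞ (e.symm.trans e') (e.symm.trans e').source := by
    simpa [contDiffPregroupoid] using h.1
  simpa using h1.restrict_scalars ℝ

variable [T2Space X] [CompactSpace X]

variable (X) in
/-- A smooth partition of unity subordinate to the cover of `X` by the domains of the charts. -/
def partition : X → X → ℝ :=
  haveI := isManifold_real X
  fun p => (SmoothPartitionOfUnity.exists_isSubordinate_chartAt_source 𝓘(ℝ, C2) X).choose p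

theorem partition_tsupport (p : X) : tsupport (partition X p) ⊆ (chartAt C2 p).source :=
  have := isManifold_real X
  (SmoothPartitionOfUnity.exists_isSubordinate_chartAt_source 𝓘(ℝ, C2) X).choose_spec p

variable (X) in
theorem partition_finite : {p : X | (Function.support (partition X p)).Nonempty}.Finite :=
  have := isManifold_real X
  (SmoothPartitionOfUnity.exists_isSubordinate_chartAt_source
    𝓘(ℝ, C2) X).choose.locallyFinite.finite_nonempty_of_compact

variable (X) in
/-- The finitely many indices at which the partition of unity is nonzero. -/
def partitionIndex : Finset X := (partition_finite X).toFinset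

theorem partition_eq_zero {p : X} (hp : p ∉ partitionIndex X) (x : X) : partition X p x = 0 := by
  by_contra h
  exact hp ((partition_finite X).mem_toFinset.2 ⟨x, h⟩)

theorem sum_partition (x : X) : ∑ p ∈ partitionIndex X, partition X p x = 1 := by
  have := isManifold_real X
  have h := (SmoothPartitionOfUnity.exists_isSubordinate_chartAt_source
    𝓘(ℝ, C2) X).choose.sum_eq_one (Set.mem_univ x)
  rw [← h]
  symm
  refine finsum_eq_sum_of_support_subset _ fun p hp => ?_
  by_contra h'
  exact hp (partition_eq_zero h' x)

theorem contDiffOn_partition (p q : X) :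
    ContDiffOn ℝ ∞ (fun y => partition X p ((chartAt C2 q).symm y)) (chartAt C2 q).target := by
  have := isManifold_real X
  have h1 : ContMDiff 𝓘(ℝ, C2) 𝓘(ℝ, ℝ) ∞ (partition X p) :=
    ((SmoothPartitionOfUnity.exists_isSubordinate_chartAt_source 𝓘(ℝ, C2) X).choose p).contMDiff
  have h2 := h1.comp_contMDiffOn (contMDiffOn_chart_symm (I := 𝓘(ℝ, C2)) (n := ∞) (x := q))
  exact h2.contDiffOn

/-- The integral over `X` of a 4-form given by its expressions in the charts, with respect to the
orientation of `X` by its complex structure. -/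
def integral (w : X → C2 → Alt 4) : ℝ :=
  ∑ᶠ p, ∫ y in (chartAt C2 p).target, partition X p ((chartAt C2 p).symm y) * w p y frame

theorem integral_eq_sum (w : X → C2 → Alt 4) : integral w = ∑ p ∈ partitionIndex X,
    ∫ y in (chartAt C2 p).target, partition X p ((chartAt C2 p).symm y) * w p y frame := by
  refine finsum_eq_sum_of_support_subset _ fun p hp => ?_
  by_contra h'
  exact hp (by simp [partition_eq_zero h'])

theorem integrableOn_of_support {p q : X} {g : C2 → ℝ}
    (hg : ContinuousOn g (chartAt C2 p).target)
    (h0 : ∀ y ∈ (chartAt C2 p).target, (chartAt C2 p).symm y ∉ tsupport (partition X q) → g y = 0)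
    (hq : tsupport (partition X q) ⊆ (chartAt C2 p).source) :
    IntegrableOn g (chartAt C2 p).target := by
  have hK : IsCompact (chartAt C2 p '' tsupport (partition X q)) :=
    (isClosed_tsupport _).isCompact.image_of_continuousOn
      ((chartAt C2 p).continuousOn.mono hq)
  have hKT : chartAt C2 p '' tsupport (partition X q) ⊆ (chartAt C2 p).target := by
    rintro _ ⟨x, hx, rfl⟩; exact (chartAt C2 p).map_source (hq hx)
  refine ((hg.mono hKT).integrableOn_compact hK).of_forall_sdiff_eq_zero
    (chartAt C2 p).open_target.measurableSet fun y hy => h0 y hy.1 fun h => hy.2 ?_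
  exact ⟨_, h, (chartAt C2 p).right_inv hy.1⟩

theorem integral_chart_change {w : X → C2 → Alt 4} {p q : X}
    (hw : ∀ y ∈ overlap p q,
      w p y = (w q (trans p q y)).compContinuousLinearMap (fderiv ℝ (trans p q) y))
    (hf : ∀ y ∈ (chartAt C2 p).target, (chartAt C2 p).symm y ∉ (chartAt C2 q).source →
      w p y frame = 0) {f : X → ℝ} (hfp : ∀ x, x ∉ (chartAt C2 p).source → f x = 0) :
    ∫ y in (chartAt C2 p).target, f ((chartAt C2 p).symm y) * w p y frame
      = ∫ y in (chartAt C2 q).target, f ((chartAt C2 q).symm y) * w q y frame := by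
  have himg : trans p q '' overlap p q = overlap q p := by
    apply Set.Subset.antisymm
    · rintro _ ⟨y, hy, rfl⟩; exact trans_mem hy
    · intro y hy; exact ⟨trans q p y, trans_mem hy, trans_trans hy⟩
  have hinj : Set.InjOn (trans p q) (overlap p q) := by
    intro y hy z hz h
    rw [← trans_trans hy, h, trans_trans hz]
  have e1 : ∫ y in overlap p q, f ((chartAt C2 p).symm y) * w p y frame
      = ∫ y in (chartAt C2 p).target, f ((chartAt C2 p).symm y) * w p y frame := by
    symm
    refine setIntegral_eq_of_subset_of_forall_sdiff_eq_zero
      (chartAt C2 p).open_target.measurableSet Set.inter_subset_left fun y hy => ?_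
    rw [hf y hy.1 fun h => hy.2 ⟨hy.1, h⟩, mul_zero]
  have e2 : ∫ y in overlap q p, f ((chartAt C2 q).symm y) * w q y frame
      = ∫ y in (chartAt C2 q).target, f ((chartAt C2 q).symm y) * w q y frame := by
    symm
    refine setIntegral_eq_of_subset_of_forall_sdiff_eq_zero
      (chartAt C2 q).open_target.measurableSet Set.inter_subset_left fun y hy => ?_
    rw [hfp _ fun h => hy.2 ⟨hy.1, h⟩, zero_mul]
  rw [← e1, ← e2, ← himg]
  rw [integral_image_eq_integral_abs_det_fderiv_smul volume (isOpen_overlap p q).measurableSet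
    (f' := fderiv ℝ (trans p q)) (fun y hy => ?_) hinj]
  · refine setIntegral_congr_fun (isOpen_overlap p q).measurableSet fun y hy => ?_
    simp only [symm_trans hy, hw y hy, alt_comp_frame, abs_of_nonneg (det_trans_nonneg hy),
      smul_eq_mul]
    ring
  · exact (((contDiffOn_trans p q).contDiffAt ((isOpen_overlap p q).mem_nhds hy)).differentiableAt
      (by simp)).hasFDerivAt.hasFDerivWithinAt

end Forms

section Stokes
variable {X : Type} [TopologicalSpace X] [ChartedSpace C2 X] [IsManifold 𝓘(ℂ, C2) ∞ X]
  [T2Space X] [CompactSpace X]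

/-- The product of a form with a function of the partition of unity. -/
def loc {k : ℕ} (q : X) (η : X → C2 → Alt k) : X → C2 → Alt k :=
  fun p y => partition X q ((chartAt C2 p).symm y) • η p y

theorem loc_mem {k : ℕ} (q : X) {η : X → C2 → Alt k} (hη : η ∈ DiffForm X k) :
    loc q η ∈ DiffForm X k := by
  refine ⟨fun p => (contDiffOn_partition q p).smul (hη.1 p), fun p p' y hy => ?_⟩
  simp only [loc, symm_trans hy, hη.2 p p' y hy]
  rfl

theorem extDeriv_zero_form {k : ℕ} (y : C2) : extDeriv (fun _ : C2 => (0 : Alt k)) y = 0 := by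
  have := extDeriv_smul (0 : ℝ) (fun _ : C2 => (0 : Alt k)) (x := y)
  exact (by simpa using this : extDeriv (0 : C2 → Alt k) y = 0)

theorem extDeriv_sum_forms {k : ℕ} {ι : Type} (s : Finset ι) (f : ι → C2 → Alt k) (y : C2)
    (h : ∀ i ∈ s, DifferentiableAt ℝ (f i) y) :
    extDeriv (fun z => ∑ i ∈ s, f i z) y = ∑ i ∈ s, extDeriv (f i) y := by
  classical
  induction s using Finset.induction_on with
  | empty => simpa using extDeriv_zero_form y
  | insert a s ha ih =>
    have h1 : ∀ i ∈ s, DifferentiableAt ℝ (f i) y := fun i hi => h i (Finset.mem_insert_of_mem hi)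
    simp only [Finset.sum_insert ha]
    rw [extDeriv_fun_add (h a (Finset.mem_insert_self a s)) (DifferentiableAt.fun_sum h1), ih h1]

theorem sum_loc {k : ℕ} (η : X → C2 → Alt k) (p : X) (y : C2) :
    η p y = ∑ q ∈ partitionIndex X, loc q η p y := by
  simp only [loc, ← Finset.sum_smul, sum_partition, one_smul]

theorem wedge_sum_left {ι : Type} (s : Finset ι) (f : ι → Alt 2) (b : Alt 2) :
    wedge (∑ i ∈ s, f i) b = ∑ i ∈ s, wedge (f i) b := by
  classical
  have h0 : wedge 0 b = 0 := by
    have := wedge_smul_left 0 0 b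
    simpa using this
  induction s using Finset.induction_on with
  | empty => simpa using h0
  | insert a s ha ih => rw [Finset.sum_insert ha, Finset.sum_insert ha, wedge_add_left, ih]

theorem loc_extDeriv_eq_zero {k : ℕ} {q : X} {η : X → C2 → Alt k} {p : X} {y : C2}
    (hy : y ∈ (chartAt C2 p).target)
    (h : (chartAt C2 p).symm y ∉ tsupport (partition X q)) : extDeriv (loc q η p) y = 0 := by
  have hm : (chartAt C2 p).symm ⁻¹' (tsupport (partition X q))ᶜ ∈ nhds y :=
    ((chartAt C2 p).continuousAt_symm hy).preimage_mem_nhds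
      ((isClosed_tsupport _).isOpen_compl.mem_nhds h)
  have he : loc q η p =ᶠ[nhds y] fun _ => 0 :=
    Filter.eventuallyEq_of_mem hm fun z hz => by
      simp only [loc, image_eq_zero_of_notMem_tsupport hz, zero_smul]
  rw [he.extDeriv_eq, extDeriv_zero_form]

theorem extDeriv_compat {k : ℕ} {η : X → C2 → Alt k} (hη : η ∈ DiffForm X k) {p q : X} {y : C2}
    (hy : y ∈ overlap p q) : extDeriv (η p) y
      = (extDeriv (η q) (trans p q y)).compContinuousLinearMap (fderiv ℝ (trans p q) y) := by
  have he : η p =ᶠ[nhds y]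
      fun z => (η q (trans p q z)).compContinuousLinearMap (fderiv ℝ (trans p q) z) :=
    Filter.eventuallyEq_of_mem ((isOpen_overlap p q).mem_nhds hy) fun z hz => hη.2 p q z hz
  rw [he.extDeriv_eq]
  exact extDeriv_pullback (r := ∞) (form_differentiableAt hη q (trans_mem hy).1)
    ((contDiffOn_trans p q).contDiffAt ((isOpen_overlap p q).mem_nhds hy))
    (by rw [minSmoothness_of_isRCLikeNormedField]; exact WithTop.coe_le_coe.2 le_top)

theorem continuousOn_extDeriv {η : X → C2 → Alt 1} (hη : η ∈ DiffForm X 1) (p : X) (u v : C2) :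
    ContinuousOn (fun y => extDeriv (η p) y ![u, v]) (chartAt C2 p).target := by
  have hT := (chartAt C2 p).open_target
  have h (e f : C2) : ContinuousOn (fun y => fderiv ℝ (fun z => η p z ![e]) y f)
      (chartAt C2 p).target :=
    ((contDiffOn_eval (hη.1 p) ![e]).continuousOn_fderiv_of_isOpen hT (by simp)).clm_apply
      continuousOn_const
  exact ((h v u).sub (h u v)).congr fun y hy => extDeriv_one (form_differentiableAt hη p hy) u v

theorem continuousOn_wedge {T : Set C2} {a b : C2 → Alt 2}
    (ha : ∀ u v, ContinuousOn (fun y => a y ![u, v]) T)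
    (hb : ∀ u v, ContinuousOn (fun y => b y ![u, v]) T) :
    ContinuousOn (fun y => wedge (a y) (b y) frame) T := by
  simp only [wedge_apply]
  exact ((((((ha _ _).mul (hb _ _)).sub ((ha _ _).mul (hb _ _))).add
      ((ha _ _).mul (hb _ _))).add ((ha _ _).mul (hb _ _))).sub
      ((ha _ _).mul (hb _ _))).add ((ha _ _).mul (hb _ _))

theorem integrableOn_partition (p q : X) (hq : tsupport (partition X q) ⊆ (chartAt C2 p).source)
    {g : C2 → ℝ} (hg : ContinuousOn g (chartAt C2 p).target) :
    IntegrableOn (fun y => partition X q ((chartAt C2 p).symm y) * g y) (chartAt C2 p).target :=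
  integrableOn_of_support ((contDiffOn_partition q p).continuousOn.mul hg)
    (fun y _ h => by rw [image_eq_zero_of_notMem_tsupport h, zero_mul]) hq

theorem stokes {η : X → C2 → Alt 1} (hη : η ∈ DiffForm X 1) {b : X → C2 → Alt 2}
    (hb : b ∈ closedForms X 2) :
    integral (fun p y => wedge (extDeriv (η p) y) (b p y)) = 0 := by
  set W : X → X → C2 → Alt 4 := fun q p y => wedge (extDeriv (loc q η p) y) (b p y) with hW
  have hbc (p : X) (u v : C2) : ContinuousOn (fun y => b p y ![u, v]) (chartAt C2 p).target :=
    (contDiffOn_eval (hb.1.1 p) _).continuousOn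
  have hWc (q p : X) : ContinuousOn (fun y => W q p y frame) (chartAt C2 p).target :=
    continuousOn_wedge (continuousOn_extDeriv (loc_mem q hη) p) (hbc p)
  have hW0 (q p : X) (y : C2) (hy : y ∈ (chartAt C2 p).target)
      (h : (chartAt C2 p).symm y ∉ tsupport (partition X q)) : W q p y frame = 0 := by
    simp [hW, loc_extDeriv_eq_zero hy h, wedge_apply]
  have hsum (p : X) (y : C2) (hy : y ∈ (chartAt C2 p).target) :
      wedge (extDeriv (η p) y) (b p y) frame = ∑ q ∈ partitionIndex X, W q p y frame := by
    have e1 : extDeriv (η p) y = ∑ q ∈ partitionIndex X, extDeriv (loc q η p) y := by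
      rw [← extDeriv_sum_forms _ _ _ fun q _ => form_differentiableAt (loc_mem q hη) p hy]
      congr 1
      funext z
      exact sum_loc η p z
    rw [e1, wedge_sum_left, ContinuousAlternatingMap.sum_apply]
  have step1 (p : X) : ∫ y in (chartAt C2 p).target, partition X p ((chartAt C2 p).symm y)
        * wedge (extDeriv (η p) y) (b p y) frame
      = ∑ q ∈ partitionIndex X, ∫ y in (chartAt C2 p).target,
        partition X p ((chartAt C2 p).symm y) * W q p y frame := by
    rw [← integral_finsetSum _ fun q _ => integrableOn_partition p p (partition_tsupport p) (hWc q p)]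
    refine setIntegral_congr_fun (chartAt C2 p).open_target.measurableSet fun y hy => ?_
    simp only [hsum p y hy, Finset.mul_sum]
  have step2 (p q : X) : ∫ y in (chartAt C2 p).target,
        partition X p ((chartAt C2 p).symm y) * W q p y frame
      = ∫ y in (chartAt C2 q).target, partition X p ((chartAt C2 q).symm y) * W q q y frame := by
    refine integral_chart_change (fun y hy => ?_) (fun y hy h => hW0 q p y hy fun h' =>
      h (partition_tsupport q h')) (fun x hx => ?_)
    · simp only [hW]
      rw [extDeriv_compat (loc_mem q hη) hy, hb.1.2 p q y hy, wedge_comp]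
    · exact image_eq_zero_of_notMem_tsupport fun h => hx (partition_tsupport p h)
  have step3 (q : X) : ∑ p ∈ partitionIndex X, ∫ y in (chartAt C2 q).target,
        partition X p ((chartAt C2 q).symm y) * W q q y frame = 0 := by
    rw [← integral_finsetSum _ fun p _ => ?_]
    · have h := local_stokes (T := (chartAt C2 q).target)
        (K := chartAt C2 q '' tsupport (partition X q)) (chartAt C2 q).open_target
        ((isClosed_tsupport _).isCompact.image_of_continuousOn
          ((chartAt C2 q).continuousOn.mono (partition_tsupport q)))
        (by rintro _ ⟨x, hx, rfl⟩; exact (chartAt C2 q).map_source (partition_tsupport q hx))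
        ((loc_mem q hη).1 q) (hb.1.1 q)
        (fun y hy h => by
          have h2 : (chartAt C2 q).symm y ∉ tsupport (partition X q) := fun h' =>
            h ⟨_, h', (chartAt C2 q).right_inv hy⟩
          simp only [loc, image_eq_zero_of_notMem_tsupport h2, zero_smul])
        (hb.2 q)
      rw [← h]
      refine setIntegral_congr_fun (chartAt C2 q).open_target.measurableSet fun y hy => ?_
      simp only [← Finset.sum_mul, sum_partition, one_mul, hW]
    · refine integrableOn_of_support ((contDiffOn_partition p q).continuousOn.mul (hWc q q))
        (fun y hy h => ?_) (partition_tsupport q)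
      rw [hW0 q q y hy h, mul_zero]
  rw [integral_eq_sum, Finset.sum_congr rfl fun p _ => step1 p, Finset.sum_comm]
  refine Finset.sum_eq_zero fun q _ => ?_
  rw [Finset.sum_congr rfl fun p _ => step2 p q, step3]

theorem integral_wedge_add {a a' b : X → C2 → Alt 2} (ha : a ∈ DiffForm X 2)
    (ha' : a' ∈ DiffForm X 2) (hb : b ∈ DiffForm X 2) :
    integral (fun p y => wedge (a p y + a' p y) (b p y))
      = integral (fun p y => wedge (a p y) (b p y)) + integral fun p y => wedge (a' p y) (b p y) := by
  have hc {a : X → C2 → Alt 2} (ha : a ∈ DiffForm X 2) (p : X) (u v : C2) :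
      ContinuousOn (fun y => a p y ![u, v]) (chartAt C2 p).target :=
    (contDiffOn_eval (ha.1 p) _).continuousOn
  have hi {a : X → C2 → Alt 2} (ha : a ∈ DiffForm X 2) (p : X) := integrableOn_partition p p
    (partition_tsupport p) (continuousOn_wedge (hc ha p) (hc hb p))
  simp only [integral_eq_sum, ← Finset.sum_add_distrib]
  refine Finset.sum_congr rfl fun p _ => ?_
  rw [← integral_add (hi ha p) (hi ha' p)]
  refine setIntegral_congr_fun (chartAt C2 p).open_target.measurableSet fun y _ => ?_
  simp only [wedge_add_left, ContinuousAlternatingMap.add_apply, mul_add]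

theorem integral_wedge_smul (c : ℝ) (a b : X → C2 → Alt 2) :
    integral (fun p y => wedge (c • a p y) (b p y))
      = c * integral (fun p y => wedge (a p y) (b p y)) := by
  simp only [integral_eq_sum, Finset.mul_sum]
  refine Finset.sum_congr rfl fun p _ => ?_
  rw [← integral_const_mul]
  refine setIntegral_congr_fun (chartAt C2 p).open_target.measurableSet fun y _ => ?_
  simp only [wedge_smul_left, ContinuousAlternatingMap.smul_apply, smul_eq_mul]
  ring

/-- The bilinear form `(a, b) ↦ ∫ a ∧ b` on closed 2-forms. -/
def pairForms : closedForms X 2 →ₗ[ℝ] closedForms X 2 →ₗ[ℝ] ℝ :=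
  LinearMap.mk₂ ℝ (fun a b => integral fun p y => wedge (a.1 p y) (b.1 p y))
    (fun a a' b => integral_wedge_add a.2.1 a'.2.1 b.2.1)
    (fun c a b => integral_wedge_smul c a.1 b.1)
    (fun a b b' => by
      simp only [wedge_comm (a.1 _ _)]
      exact integral_wedge_add b.2.1 b'.2.1 a.2.1)
    (fun c a b => by
      simp only [wedge_comm (a.1 _ _)]
      exact integral_wedge_smul c b.1 a.1)

theorem pairForms_exact {a : closedForms X 2} (ha : a ∈ exactForms X) (b : closedForms X 2) :
    pairForms a b = 0 := by
  obtain ⟨η, hη, h⟩ := ha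
  refine Eq.trans ?_ (stokes hη b.2)
  change integral _ = integral _
  simp only [integral_eq_sum]
  refine Finset.sum_congr rfl fun p _ => ?_
  refine setIntegral_congr_fun (chartAt C2 p).open_target.measurableSet fun y hy => ?_
  simp only [h p y hy]

theorem pairForms_comm (a b : closedForms X 2) : pairForms a b = pairForms b a := by
  change integral _ = integral _
  simp only [wedge_comm (a.1 _ _)]

variable (X) in
/-- The intersection pairing `([a], [b]) ↦ ∫ a ∧ b` on `H²(X, ℝ)`. -/
def pairing : H2 X →ₗ[ℝ] H2 X →ₗ[ℝ] ℝ :=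
  (exactForms X).liftQ
    (LinearMap.flip ((exactForms X).liftQ (LinearMap.flip pairForms) fun b hb => by
      ext a
      exact (pairForms_comm a b).trans (pairForms_exact hb a)))
    fun a ha => by
      apply LinearMap.ext
      intro c
      obtain ⟨b, rfl⟩ := (exactForms X).mkQ_surjective c
      exact pairForms_exact ha b

theorem pairing_mk (a b : closedForms X 2) : pairing X ((exactForms X).mkQ a)
    ((exactForms X).mkQ b) = integral fun p y => wedge (a.1 p y) (b.1 p y) := rfl

end Stokes

section Sheaves
variable (X : Type) [TopologicalSpace X] [ChartedSpace C2 X]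

/-- The sheaf of holomorphic functions on `X`. -/
abbrev holSheaf : TopCat.Sheaf CommRingCat.{0} (TopCat.of X) :=
  smoothSheafCommRing 𝓘(ℂ, C2) 𝓘(ℂ) X ℂ

/-- The structure sheaf, as a sheaf of rings. -/
abbrev structureSheaf : TopCat.Sheaf RingCat.{0} (TopCat.of X) :=
  (sheafCompose _ (forget₂ CommRingCat.{0} RingCat.{0})).obj (holSheaf X)

/-- The abelian category of sheaves of modules over the structure sheaf. -/
abbrev SheafMod : Type 1 := SheafOfModules.{0} (structureSheaf X)

variable {X}

/-- Sections of `F` over `U`. -/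
abbrev Sec (F : SheafMod X) (U : Opens X) : Type := F.val.obj (op (U : Opens (TopCat.of X)))

/-- Holomorphic functions on `U`. -/
abbrev Hol (U : Opens X) : Type := (structureSheaf X).obj.obj (op (U : Opens (TopCat.of X)))

/-- The value of a holomorphic function at a point. -/
def ev {U : Opens X} (f : Hol U) (x : X) (hx : x ∈ U) : ℂ := f.1 ⟨x, hx⟩

/-- Restriction of sections. -/
def res (F : SheafMod X) {U W : Opens X} (h : W ≤ U) (s : Sec F U) : Sec F W :=
  F.val.map (homOfLE h).op s

/-- Coherent analytic sheaves: locally, `F` is the cokernel of a morphism between free sheaves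
of finite rank (over the coherent ring of holomorphic functions this is coherence). -/
def IsCoherent (F : SheafMod X) : Prop := F.IsFinitePresentation

/-- Holomorphic vector bundles of rank `r`: `F` is locally free with bases of `r` elements. -/
def IsVectorBundle (F : SheafMod X) (r : ℕ) : Prop :=
  ∃ q : SheafOfModules.LocalGeneratorsData.{0} F, q.IsLocallyFreeData ∧
    ∀ i, Finite (q.generators i).I ∧ Nat.card (q.generators i).I = r

/-- The rank of the stalk of a presheaf of modules at `x` over the stalk of the ring at `x`. -/
def stalkRank {Y : TopCat.{0}} {R : Y.Presheaf CommRingCat.{0}}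
    (M : PresheafOfModules.{0} (R ⋙ forget₂ CommRingCat.{0} RingCat.{0})) (x : Y) : ℕ :=
  Module.finrank (R.stalk x) ↑(TopCat.Presheaf.stalk M.presheaf x)

/-- The rank of a coherent sheaf: the rank of a stalk over the local ring, which is an integral
domain. Since `X` is connected, the choice of the point is immaterial. -/
def rank [ConnectedSpace X] (F : SheafMod X) : ℕ :=
  stalkRank (R := (holSheaf X).presheaf) F.val (Classical.arbitrary X)

/-- Torsion-free sheaves: no nonzero section is killed by a holomorphic function that does not
vanish identically on any nonempty open subset. -/
def IsTorsionFree (F : SheafMod X) : Prop :=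
  ∀ (U : Opens X) (f : Hol U) (s : Sec F U),
    (U : Set X) ⊆ closure {x | ∃ hx : x ∈ U, ev f x hx ≠ 0} → f • s = 0 → s = 0

/-- The sections `e` form a frame (a basis of the sheaf) over `U`. -/
def IsFrame {V : SheafMod X} {U : Opens X} {r : ℕ} (e : Fin r → Sec V U) : Prop :=
  ∀ (W : Opens X) (h : W ≤ U), LinearIndependent (Hol W) (fun a => res V h (e a)) ∧
    Submodule.span (Hol W) (Set.range fun a => res V h (e a)) = ⊤

/-- Smooth Hermitian metrics on a holomorphic vector bundle, as pairings of holomorphic sections;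
`inner U s t x` is relevant for `x ∈ U` only. -/
structure HermitianMetric (V : SheafMod X) where
  inner : ∀ U : Opens X, Sec V U → Sec V U → X → ℂ
  inner_res : ∀ (U W : Opens X) (h : W ≤ U) (s t : Sec V U), ∀ x ∈ W,
    inner W (res V h s) (res V h t) x = inner U s t x
  inner_add : ∀ (U : Opens X) (s s' t : Sec V U), ∀ x ∈ U,
    inner U (s + s') t x = inner U s t x + inner U s' t x
  inner_smul : ∀ (U : Opens X) (f : Hol U) (s t : Sec V U) (x : X) (hx : x ∈ U),
    inner U (f • s) t x = ev f x hx * inner U s t x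
  inner_symm : ∀ (U : Opens X) (s t : Sec V U), ∀ x ∈ U,
    inner U t s x = starRingEnd ℂ (inner U s t x)
  inner_smooth : ∀ (U : Opens X) (s t : Sec V U) (p : X),
    ContDiffOn ℝ ∞ (fun y => inner U s t ((chartAt C2 p).symm y))
      ((chartAt C2 p).target ∩ (chartAt C2 p).symm ⁻¹' U)
  inner_pos : ∀ (U : Opens X) (r : ℕ) (e : Fin r → Sec V U), IsFrame e → ∀ x ∈ U,
    (Matrix.of fun a b => inner U (e a) (e b) x).PosDef

/-- The value of `∂f` at `y` on the tangent vector `v`. -/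
def del (f : C2 → ℂ) (y v : C2) : ℂ :=
  (1 / 2) * (fderiv ℝ f y v - Complex.I * fderiv ℝ f y (Complex.I • v))

/-- The value of `∂̄f` at `y` on the tangent vector `v`. -/
def delbar (f : C2 → ℂ) (y v : C2) : ℂ :=
  (1 / 2) * (fderiv ℝ f y v + Complex.I * fderiv ℝ f y (Complex.I • v))

/-- The matrix `h(e_a, e_b)` of the metric in a frame, in the chart at `p`. -/
def gram {V : SheafMod X} (h : HermitianMetric V) {U : Opens X} {r : ℕ} (e : Fin r → Sec V U) (p : X)
    (y : C2) : Matrix (Fin r) (Fin r) ℂ :=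
  Matrix.of fun a b => h.inner U (e a) (e b) ((chartAt C2 p).symm y)

/-- The Chern connection matrix `θ = ∂H · H⁻¹`. -/
def connection {r : ℕ} (H : C2 → Matrix (Fin r) (Fin r) ℂ) (y v : C2) :
    Matrix (Fin r) (Fin r) ℂ :=
  (Matrix.of fun a b => del (fun z => H z a b) y v) * (H y)⁻¹

/-- The normalized curvature matrix `(i / 2π) ∂̄θ` of the Chern connection, evaluated on `v`, `w`. -/
def curvature {r : ℕ} (H : C2 → Matrix (Fin r) (Fin r) ℂ) (y v w : C2) :
    Matrix (Fin r) (Fin r) ℂ :=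
  (Complex.I / (2 * Real.pi)) • Matrix.of fun a b =>
    delbar (fun z => connection H z w a b) y v - delbar (fun z => connection H z v a b) y w

/-- `c₁` and `c₂` are the Chern character forms of the metric `h`: with `𝓕` the normalized
curvature, `c₁ = tr 𝓕` and `c₂ = (1/2) tr (𝓕 ∧ 𝓕)` in every frame and every chart. -/
def AreChernForms {V : SheafMod X} (h : HermitianMetric V) (c₁ : X → C2 → Alt 2)
    (c₂ : X → C2 → Alt 4) : Prop :=
  ∀ (U : Opens X) (r : ℕ) (e : Fin r → Sec V U), IsFrame e →
    ∀ (p : X), ∀ y ∈ (chartAt C2 p).target, (chartAt C2 p).symm y ∈ U →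
      (∀ v w : C2, c₁ p y ![v, w] = (curvature (gram h e p) y v w).trace.re) ∧
      ∀ v : Fin 4 → C2, c₂ p y v =
        let m (i j k l : Fin 4) : ℂ :=
          (curvature (gram h e p) y (v i) (v j) * curvature (gram h e p) y (v k) (v l)).trace
        ((1 / 2) * (m 0 1 2 3 - m 0 2 1 3 + m 0 3 1 2 + m 1 2 0 3 - m 1 3 0 2 + m 2 3 0 1)).re

variable [IsManifold 𝓘(ℂ, C2) ∞ X] [T2Space X] [CompactSpace X]

/-- `c` assigns to each coherent sheaf `F` its Chern character `(ch₁(F), ∫ ch₂(F))`: it is additive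
on short exact sequences of coherent sheaves, and on vector bundles it is given by the Chern
character forms of Hermitian metrics. As every coherent sheaf on a compact complex surface has a
finite resolution by vector bundles, this determines `c` on coherent sheaves. -/
def IsChernCharacter (c : SheafMod X → H2 X × ℝ) : Prop :=
  (∀ S : ShortComplex (SheafMod X), S.ShortExact → IsCoherent S.X₁ → IsCoherent S.X₂ →
    IsCoherent S.X₃ → c S.X₂ = c S.X₁ + c S.X₃) ∧
  ∀ (V : SheafMod X) (r : ℕ), IsVectorBundle V r → ∀ (h : HermitianMetric V) (c₁ : closedForms X 2)
    (c₂ : DiffForm X 4), AreChernForms h c₁.1 c₂.1 →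
      c V = ((exactForms X).mkQ c₁, integral c₂.1)

open Classical in
/-- The Chern character of coherent sheaves in degrees 2 and 4. -/
def chernCharacter (F : SheafMod X) : H2 X × ℝ :=
  if h : ∃ c : SheafMod X → H2 X × ℝ, IsChernCharacter c then h.choose F else 0

/-- `ch₁(F)` in `H²(X, ℝ)`. -/
def ch1 (F : SheafMod X) : H2 X := (chernCharacter F).1

/-- `ch₂(F)`, integrated over `X`. -/
def ch2 (F : SheafMod X) : ℝ := (chernCharacter F).2

end Sheaves

section Charges
variable (X : Type) [TopologicalSpace X] [ChartedSpace C2 X]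

variable {X} in
/-- Real 2-forms of type `(1, 1)`. -/
def IsOneOne (w : X → C2 → Alt 2) : Prop :=
  ∀ p, ∀ y ∈ (chartAt C2 p).target, ∀ u v : C2,
    w p y ![Complex.I • u, Complex.I • v] = w p y ![u, v]

variable {X} in
/-- Positivity of a real `(1, 1)`-form. -/
def IsPositive (w : X → C2 → Alt 2) : Prop :=
  ∀ p, ∀ y ∈ (chartAt C2 p).target, ∀ v : C2, v ≠ 0 → 0 < w p y ![v, Complex.I • v]

/-- The data of a polynomial central charge on a surface: a Kähler form `ω` (the field `kahler`), a stability vector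
`(ρ₀, ρ₁, ρ₂)`, and a representative `1 + u₁ + u₂` by real closed forms of type `(j, j)` of a
unipotent cohomology class. -/
structure CentralCharge where
  kahler : closedForms X 2
  kahler_oneOne : IsOneOne kahler.1
  kahler_pos : IsPositive kahler.1
  ρ : Fin 3 → ℂ
  ρ_ne_zero : ∀ j, ρ j ≠ 0
  ρ_im : ∀ j : Fin 2, 0 < (ρ j.castSucc / ρ j.succ).im
  u₁ : closedForms X 2
  u₁_oneOne : IsOneOne u₁.1
  u₂ : DiffForm X 4

variable {X} [IsManifold 𝓘(ℂ, C2) ∞ X] [T2Space X] [CompactSpace X] [ConnectedSpace X]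

namespace CentralCharge
variable (Z : CentralCharge X)

/-- The Kähler class. -/
def kahlerClass : H2 X := (exactForms X).mkQ Z.kahler

/-- The class `U₁` of `u₁`. -/
def uClass : H2 X := (exactForms X).mkQ Z.u₁

/-- The central charge `Z_X(F) = ∫_X (ρ₀ + ρ₁ ω + ρ₂ ω²) · ch(F) · (1 + U₁ + U₂)` of a coherent
sheaf `F`. -/
def charge (F : SheafMod X) : ℂ :=
  (Z.ρ 0 * integral Z.u₂.1 + Z.ρ 1 * pairing X Z.uClass Z.kahlerClass
      + Z.ρ 2 * pairing X Z.kahlerClass Z.kahlerClass) * rank F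
    + Z.ρ 0 * pairing X Z.uClass (ch1 F) + Z.ρ 1 * pairing X Z.kahlerClass (ch1 F)
    + Z.ρ 0 * ch2 F

/-- `exp(-i ϑ_E)`, where `ϑ_E` is the argument of `Z_X(E)`. -/
def phase (E : SheafMod X) : ℂ := Complex.exp (-Complex.I * (Z.charge E).arg)

/-- `α = (1/2) Im(exp(-i ϑ_E) ρ₀)`. -/
def alpha (E : SheafMod X) : ℝ := (1 / 2) * (Z.phase E * Z.ρ 0).im

/-- `β = Im(exp(-i ϑ_E) (ρ₀ u₁ + ρ₁ ω))`, a closed real 2-form. -/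
def beta (E : SheafMod X) : closedForms X 2 :=
  (Z.phase E * Z.ρ 0).im • Z.u₁ + (Z.phase E * Z.ρ 1).im • Z.kahler

/-- The class `ϑ = [β / 2α]`. -/
def twist (E : SheafMod X) : H2 X := (exactForms X).mkQ ((1 / (2 * Z.alpha E)) • Z.beta E)

end CentralCharge

/-- The twisted Monge–Ampère slope `μ_{MA,ϑ}(F) = (ch₂(F) + ch₁(F) · ϑ) / rk F`. -/
def slopeMA (ϑ : H2 X) (F : SheafMod X) : ℝ := (ch2 F + pairing X (ch1 F) ϑ) / rank F

/-- `E` is `Z`-stable: `Im(Z_X(Q) / Z_X(E)) > 0` for every coherent torsion-free quotient `Q` of `E`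
with `0 < rk Q < rk E`. -/
def ZStable (Z : CentralCharge X) (E : SheafMod X) : Prop :=
  ∀ (S Q : SheafMod X) (i : S ⟶ E) (p : E ⟶ Q) (w : i ≫ p = 0), (ShortComplex.mk i p w).ShortExact →
    IsCoherent S → IsCoherent Q → IsTorsionFree Q → 0 < rank Q → rank Q < rank E →
      0 < (Z.charge Q / Z.charge E).im

/-- `E` is twisted Monge–Ampère stable: `μ_{MA,ϑ}(S) < μ_{MA,ϑ}(E)` for every coherent saturated
subsheaf `S` of `E` with `0 < rk S < rk E`; saturated means that `E / S` is torsion-free. -/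
def MAStable (ϑ : H2 X) (E : SheafMod X) : Prop :=
  ∀ (S Q : SheafMod X) (i : S ⟶ E) (p : E ⟶ Q) (w : i ≫ p = 0), (ShortComplex.mk i p w).ShortExact →
    IsCoherent S → IsCoherent Q → IsTorsionFree Q → 0 < rank S → rank S < rank E →
      slopeMA ϑ S < slopeMA ϑ E

end Charges

end

end KahlerSurface

/-!
Multiplying the central charge by `exp(-i ϑ_E)` makes `Z_X(E)` real and positive. For a coherent
sheaf `F` the imaginary part of `exp(-i ϑ_E) Z_X(F)` is
`c · rk F + 2 α (ch₂(F) + ch₁(F) · ϑ)`, where the real number `c` does not depend on `F`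
(`CentralCharge.phase_mul_charge_im`). It vanishes at `F = E`, so `c = -2 α μ(E)` as soon as
`rk E > 0`, and for `rk S > 0` the imaginary part becomes `2 α rk S (μ(S) - μ(E))`; this is the
formula for `Im (Z_X(S) * conj Z_X(E))`. A subsheaf `S` of positive rank forces `rk E > 0`.

For an exact sequence `0 → S → E → Q → 0` both the rank and the Chern character are additive. Hence
`0 < rk Q < rk E` is the same condition as `0 < rk S < rk E`, and
`Im (Z_X(Q) / Z_X(E)) = -Im (Z_X(S) / Z_X(E))` has the sign of `α (μ(E) - μ(S))`.

The sheaf theory behind this is the behaviour of the rank, defined by stalks.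
* The ring of germs of holomorphic functions is an integral domain (`holSheaf_stalk_isDomain`), by
  the identity theorem on complex lines.
* Taking stalks is exact and linear over that ring (`stalkMap_injective`, `stalkMap_surjective`,
  `stalkMap_exact`). Exactness on the right needs that an epimorphism of sheaves of modules is an
  epimorphism of the underlying abelian sheaves
  (`SheafOfModules.toSheaf_preservesEpimorphisms`).
* The stalks of a vector bundle are finitely generated (`IsVectorBundle.finite_stalk`), so that
  ranks of subsheaves and quotients are finite and `Module.finrank` is additive (`rank_add`).
* A vector bundle is coherent (`IsVectorBundle.isCoherent`), so that the additivity of the Chern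
  character applies to exact sequences with `E` in the middle.
-/

/-! ### Epimorphisms of sheaves of modules -/

open Limits in
/-- Forgetting the module structure preserves epimorphisms. An epimorphism `φ` of sheaves of
modules is the sheafification of its underlying morphism of presheaves, whose image factorization
`φ = ι ∘ p` sheafifies to an isomorphism `ι` and an epimorphism `p`. Sheafification of modules is
sheafification of the underlying abelian presheaves, so `p` stays an epimorphism there. -/
theorem SheafOfModules.toSheaf_preservesEpimorphisms {C : Type*} [Category* C]
    {J : GrothendieckTopology C} (R : Sheaf J RingCat.{0}) [HasSheafify J AddCommGrpCat.{0}]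
    [J.WEqualsLocallyBijective AddCommGrpCat.{0}] :
    (SheafOfModules.toSheaf.{0} R).PreservesEpimorphisms where
  preserves {F G} φ hφ := by
    let adj := PresheafOfModules.sheafificationAdjunction.{0} (𝟙 R.obj)
    let L := PresheafOfModules.sheafification.{0} (𝟙 R.obj)
    let U := SheafOfModules.forget.{0} R ⋙ PresheafOfModules.restrictScalars (𝟙 R.obj)
    have hnat : L.map (U.map φ) ≫ adj.counit.app G = adj.counit.app F ≫ φ := adj.counit.naturality φ
    have hfac := Abelian.image.fac (U.map φ)
    -- The inclusion of the image sheafifies to a monomorphism that is also an epimorphism.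
    have : IsIso (L.map (Abelian.image.ι (U.map φ))) := by
      have h1 : Mono (L.map (Abelian.image.ι (U.map φ))) := inferInstance
      have h2 : Epi (L.map (Abelian.image.ι (U.map φ))) := by
        have : Epi (L.map (U.map φ)) := by
          have : L.map (U.map φ) = adj.counit.app F ≫ φ ≫ inv (adj.counit.app G) := by
            rw [← Category.assoc, ← hnat, Category.assoc, IsIso.hom_inv_id, Category.comp_id]
          rw [this]; infer_instance
        rw [← hfac, L.map_comp] at this
        exact epi_of_epi (L.map (Abelian.factorThruImage (U.map φ))) _
      exact isIso_of_mono_of_epi _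
    have h3 : Epi ((SheafOfModules.toSheaf R).map (L.map (Abelian.factorThruImage (U.map φ)))) := by
      -- Sheafification commutes with forgetting the module structure, by definition.
      change Epi ((presheafToSheaf J AddCommGrpCat).map ((PresheafOfModules.toPresheaf _).map
        (Abelian.factorThruImage (U.map φ))))
      infer_instance
    have h4 : φ = inv (adj.counit.app F) ≫ (L.map (Abelian.factorThruImage (U.map φ)) ≫
        L.map (Abelian.image.ι (U.map φ))) ≫ adj.counit.app G := by
      rw [← L.map_comp, hfac, hnat]; simp
    rw [h4]
    simp only [Functor.map_comp]
    infer_instance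

/-! ### The local rings of holomorphic functions -/

namespace KahlerSurface

/-- The identity theorem on a convex open set, in any number of variables: it follows from the
identity theorem in one variable on the complex line through `a` and a given point. -/
theorem eqOn_zero_of_convex {E : Type*} [NormedAddCommGroup E] [NormedSpace ℂ E] {B : Set E}
    (hB : IsOpen B) (hconv : Convex ℝ B) {g : E → ℂ} (hg : DifferentiableOn ℂ g B) {a : E}
    (ha : a ∈ B) (h0 : g =ᶠ[nhds a] 0) : Set.EqOn g 0 B := by
  intro z hz
  let l : ℂ → E := fun t => a + t • (z - a)
  have hl : Differentiable ℂ l := by fun_prop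
  have hS : IsOpen (l ⁻¹' B) := hB.preimage hl.continuous
  have hSc : Convex ℝ (l ⁻¹' B) := by
    intro s hs t ht p q hp hq hpq
    have := hconv hs ht hp hq hpq
    have e : p • l s + q • l t = l (p • s + q • t) := by
      have hq' : q = 1 - p := by linarith
      subst hq'
      simp only [l, ← Complex.coe_smul, smul_eq_mul, smul_add, smul_smul, add_smul]
      push_cast
      module
    rwa [e] at this
  have hd : AnalyticOnNhd ℂ (g ∘ l) (l ⁻¹' B) :=
    (hg.comp hl.differentiableOn fun _ h => h).analyticOnNhd hS
  have hl0 : l 0 = a := by simp [l]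
  have hl1 : l 1 = z := by simp [l]
  have h := hd.eqOn_zero_of_preconnected_of_eventuallyEq_zero hSc.isPreconnected (z₀ := 0)
    (by simpa [hl0] using ha) (by
      have : Filter.Tendsto l (nhds 0) (nhds a) := by
        simpa [hl0] using hl.continuous.tendsto 0
      exact this.eventually h0)
  have := h (x := 1) (by simpa [hl1] using hz)
  simpa [hl1] using this

variable {X : Type} [TopologicalSpace X] [ChartedSpace C2 X] [IsManifold 𝓘(ℂ, C2) ∞ X]

/-- A holomorphic function on `U`, extended by zero to `X` and read in a chart, is complex
differentiable on every set of chart coordinates of points of `U`. -/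
theorem differentiableOn_chart_symm_of_hol {U : Opens X}
    (f : (holSheaf X).presheaf.obj (op (U : Opens (TopCat.of X)))) (p : X) {B : Set C2}
    (hBt : B ⊆ (chartAt C2 p).target) (hBU : ∀ y ∈ B, (chartAt C2 p).symm y ∈ U) :
    DifferentiableOn ℂ (fun y => Function.extend Subtype.val f.1 0 ((chartAt C2 p).symm y)) B := by
  intro y hy
  have h1 : ContMDiffAt 𝓘(ℂ, C2) 𝓘(ℂ) ∞ (Function.extend Subtype.val f.1 (0 : X → ℂ))
      ((chartAt C2 p).symm y) := by
    have := smoothSheaf.contMDiff_section (IM := 𝓘(ℂ, C2)) (I := 𝓘(ℂ)) (M := X) (N := ℂ) f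
    rw [← contMDiffAt_subtype_iff (U := U) (x := ⟨_, hBU y hy⟩)]
    have h := this ⟨_, hBU y hy⟩
    convert h using 1
    funext x
    exact Function.Injective.extend_apply Subtype.val_injective _ _ _
  have h2 : ContMDiffAt 𝓘(ℂ, C2) 𝓘(ℂ, C2) ∞ (chartAt C2 p).symm y :=
    (contMDiffOn_chart_symm (x := p)).contMDiffAt ((chartAt C2 p).open_target.mem_nhds (hBt hy))
  have h3 := (h1.comp y h2).contDiffAt
  exact (h3.differentiableAt (by simp)).differentiableWithinAt

omit [IsManifold 𝓘(ℂ, C2) ∞ X] in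
theorem germ_eq_zero {U N : Opens X} {x : X} (hxN : x ∈ N) (hxU : x ∈ U) (hNU : N ≤ U)
    (f : (holSheaf X).presheaf.obj (op (U : Opens (TopCat.of X))))
    (h : ∀ y (hy : y ∈ N), f.1 ⟨y, hNU hy⟩ = 0) :
    (holSheaf X).presheaf.germ U x hxU f = 0 := by
  rw [← map_zero ((holSheaf X).presheaf.germ U x hxU).hom]
  refine TopCat.Presheaf.germ_ext _ N hxN (homOfLE hNU) (homOfLE hNU) ?_
  apply Subtype.ext
  funext y
  exact h y y.2

/-- The local ring of germs of holomorphic functions at a point is an integral domain: if `f g = 0`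
on a chart ball and `f` is nonzero at one of its points, then `g` vanishes near that point, hence on
the whole ball. -/
instance holSheaf_stalk_isDomain (x : X) : IsDomain ((holSheaf X).presheaf.stalk x) := by
  have : NoZeroDivisors ((holSheaf X).presheaf.stalk x) := by
    constructor
    intro a b hab
    obtain ⟨U, hxU, f, rfl⟩ := (holSheaf X).presheaf.exists_germ_eq a
    obtain ⟨V, hxV, g, rfl⟩ := (holSheaf X).presheaf.exists_germ_eq b
    obtain ⟨W, hxW, hWU, hWV, hprod⟩ : ∃ (W : Opens X) (_ : x ∈ W) (hU : W ≤ U) (hV : W ≤ V),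
        ∀ y (hy : y ∈ W), f.1 ⟨y, hU hy⟩ * g.1 ⟨y, hV hy⟩ = 0 := by
      rw [← TopCat.Presheaf.germ_res_apply _ (homOfLE inf_le_left : U ⊓ V ⟶ U) x ⟨hxU, hxV⟩ f,
        ← TopCat.Presheaf.germ_res_apply _ (homOfLE inf_le_right : U ⊓ V ⟶ V) x ⟨hxU, hxV⟩ g,
        ← map_mul, ← map_zero ((holSheaf X).presheaf.germ (U ⊓ V) x ⟨hxU, hxV⟩).hom] at hab
      obtain ⟨W, hxW, i, j, h⟩ := TopCat.Presheaf.germ_eq _ _ _ _ _ _ hab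
      refine ⟨W, hxW, i.le.trans inf_le_left, i.le.trans inf_le_right, fun y hy => ?_⟩
      exact congrFun (congrArg Subtype.val h) ⟨y, hy⟩
    set c := chartAt C2 x
    have hopen : IsOpen (c.target ∩ c.symm ⁻¹' W) := c.isOpen_inter_preimage_symm W.2
    obtain ⟨ε, hε, hball⟩ := Metric.isOpen_iff.1 hopen (c x)
      ⟨mem_chart_target C2 x, by simpa [c] using hxW⟩
    set B := Metric.ball (c x) ε
    have hBW : ∀ y ∈ B, c.symm y ∈ W := fun y hy => (hball hy).2
    have hBt : B ⊆ c.target := fun y hy => (hball hy).1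
    have hf := differentiableOn_chart_symm_of_hol f x hBt fun y hy => hWU (hBW y hy)
    have hg := differentiableOn_chart_symm_of_hol g x hBt fun y hy => hWV (hBW y hy)
    let N : Opens X := ⟨c.source ∩ c ⁻¹' B, c.isOpen_inter_preimage Metric.isOpen_ball⟩
    have hxN : x ∈ N := ⟨mem_chart_source C2 x, Metric.mem_ball_self hε⟩
    have hNW : N ≤ W := fun y hy => by
      have := hBW _ hy.2
      rwa [c.left_inv hy.1] at this
    have hext {U : Opens X} (hWU : W ≤ U)
        (f : (holSheaf X).presheaf.obj (op (U : Opens (TopCat.of X)))) (y : X) (hy : y ∈ W) :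
        Function.extend Subtype.val f.1 0 y = f.1 ⟨y, hWU hy⟩ :=
      Function.Injective.extend_apply Subtype.val_injective _ _ (⟨y, hWU hy⟩ : U)
    by_cases hz : Set.EqOn (fun y => Function.extend Subtype.val f.1 0 (c.symm y)) 0 B
    · left
      refine germ_eq_zero hxN hxU (hNW.trans hWU) f fun y hy => ?_
      rw [← hext hWU f y (hNW hy)]
      simpa [c.left_inv hy.1] using hz hy.2
    · right
      obtain ⟨a, ha, hfa⟩ : ∃ a ∈ B, Function.extend Subtype.val f.1 0 (c.symm a) ≠ 0 := by
        simpa [Set.EqOn] using hz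
      have hBn : B ∈ nhds a := Metric.isOpen_ball.mem_nhds ha
      have hz' := eqOn_zero_of_convex Metric.isOpen_ball (convex_ball _ _) hg ha (by
        filter_upwards [(hf.continuousOn.continuousAt hBn).eventually_ne hfa, hBn] with y hy hyB
        have := hprod _ (hBW y hyB)
        rw [← hext hWU f _ (hBW y hyB), ← hext hWV g _ (hBW y hyB)] at this
        exact (mul_eq_zero.1 this).resolve_left hy)
      refine germ_eq_zero hxN hxV (hNW.trans hWV) g fun y hy => ?_
      rw [← hext hWV g y (hNW hy)]
      have h := hz' hy.2
      simp only at h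
      rwa [show (chartAt C2 x).symm (c y) = y from c.left_inv hy.1] at h
  exact NoZeroDivisors.to_isDomain _

end KahlerSurface

noncomputable section

/-! ### Stalks of sheaves of modules -/

namespace PresheafOfModules
variable {Y : TopCat.{0}} {R : Y.Presheaf CommRingCat.{0}}
  {M N : PresheafOfModules.{0} (R ⋙ forget₂ CommRingCat.{0} RingCat.{0})}

/-- The additive map induced on stalks by a morphism of presheaves of modules. -/
def stalkAddHom (φ : M ⟶ N) (x : Y) :
    ↑(TopCat.Presheaf.stalk M.presheaf x) →+ ↑(TopCat.Presheaf.stalk N.presheaf x) :=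
  ((TopCat.Presheaf.stalkFunctor AddCommGrpCat x).map
    ((PresheafOfModules.toPresheaf _).map φ)).hom

theorem stalkAddHom_germ (φ : M ⟶ N) (x : Y) (U : Opens Y) (hx : x ∈ U) (m : M.obj (op U)) :
    stalkAddHom φ x (TopCat.Presheaf.germ M.presheaf U x hx m) =
      TopCat.Presheaf.germ N.presheaf U x hx (φ.app (op U) m) :=
  TopCat.Presheaf.stalkFunctor_map_germ_apply U x hx ((PresheafOfModules.toPresheaf _).map φ) m

/-- A morphism of presheaves of modules induces a map on stalks that is linear over the stalk of the
ring. -/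
def stalkLinearMap (φ : M ⟶ N) (x : Y) :
    ↑(TopCat.Presheaf.stalk M.presheaf x) →ₗ[R.stalk x] ↑(TopCat.Presheaf.stalk N.presheaf x) where
  __ := stalkAddHom φ x
  map_smul' r m := by
    obtain ⟨U, hxU, r, rfl⟩ := R.exists_germ_eq r
    obtain ⟨V, hVU, hxV, (m : M.obj (op V)), rfl⟩ :=
      TopCat.Presheaf.exists_le_germ_eq M.presheaf m hxU
    rw [← R.germ_res_apply (homOfLE hVU) x hxV r]
    have h1 := germ_smul M x V hxV (R.map (homOfLE hVU).op r) m
    have h2 := germ_smul N x V hxV (R.map (homOfLE hVU).op r) (φ.app (op V) m)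
    have h3 := stalkAddHom_germ φ x V hxV m
    have h4 := stalkAddHom_germ φ x V hxV ((R.map (homOfLE hVU).op r : R.obj (op V)) • m)
    have h5 := (φ.app (op V)).hom.map_smul (R.map (homOfLE hVU).op r : R.obj (op V)) m
    exact (congrArg (stalkAddHom φ x) h1).symm.trans (h4.trans ((congrArg _ h5).trans
      (h2.trans (congrArg _ h3.symm))))

end PresheafOfModules

namespace KahlerSurface
variable {X : Type} [TopologicalSpace X] [ChartedSpace C2 X]

/-- The stalk of a sheaf of modules at `x`: the module over the stalk of `holSheaf X` whose
`finrank` is used to define `rank`. -/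
def Stalk (F : SheafMod X) (x : X) : Type :=
  ↑(TopCat.Presheaf.stalk (PresheafOfModules.presheaf
    (R := (holSheaf X).presheaf ⋙ forget₂ CommRingCat.{0} RingCat.{0}) F.val) x)

instance (F : SheafMod X) (x : X) : AddCommGroup (Stalk F x) :=
  inferInstanceAs <| AddCommGroup ↑(TopCat.Presheaf.stalk (PresheafOfModules.presheaf
    (R := (holSheaf X).presheaf ⋙ forget₂ CommRingCat.{0} RingCat.{0}) F.val) x)

instance (F : SheafMod X) (x : X) : Module ((holSheaf X).presheaf.stalk x) (Stalk F x) :=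
  PresheafOfModules.instModuleCarrierStalkCommRingCatCarrierAbPresheafOpensCarrier
    (R := (holSheaf X).presheaf) F.val x

/-- The linear map on stalks at `x` induced by a morphism of sheaves of modules. -/
def stalkMap {F G : SheafMod X} (φ : F ⟶ G) (x : X) :
    Stalk F x →ₗ[(holSheaf X).presheaf.stalk x] Stalk G x :=
  PresheafOfModules.stalkLinearMap (R := (holSheaf X).presheaf) φ.val x

variable (X) in
/-- The functor that forgets the module structure of a sheaf of modules. -/
abbrev toAbSheaf : SheafMod X ⥤ TopCat.Sheaf AddCommGrpCat.{0} (TopCat.of X) :=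
  SheafOfModules.toSheaf (structureSheaf X)

variable (X) in
/-- The stalk functor on sheaves of modules, with values in abelian groups. -/
abbrev stalkFunctor (x : X) : SheafMod X ⥤ AddCommGrpCat.{0} :=
  toAbSheaf X ⋙ TopCat.Sheaf.forget AddCommGrpCat (TopCat.of X) ⋙
    TopCat.Presheaf.stalkFunctor AddCommGrpCat x

open Limits in
instance (x : X) : PreservesFiniteLimits (stalkFunctor X x) :=
  have : PreservesFiniteLimits (toAbSheaf X) :=
    inferInstanceAs (PreservesFiniteLimits (SheafOfModules.toSheaf (structureSheaf X)))
  comp_preservesFiniteLimits (toAbSheaf X) _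

instance (x : X) : (stalkFunctor X x).PreservesEpimorphisms :=
  have : (toAbSheaf X).PreservesEpimorphisms :=
    SheafOfModules.toSheaf_preservesEpimorphisms (structureSheaf X)
  Functor.preservesEpimorphisms_comp (toAbSheaf X) _

theorem stalkMap_injective {F G : SheafMod X} (φ : F ⟶ G) [Mono φ] (x : X) :
    Function.Injective (stalkMap φ x) :=
  (AddCommGrpCat.mono_iff_injective ((stalkFunctor X x).map φ)).1 inferInstance

theorem stalkMap_surjective {F G : SheafMod X} (φ : F ⟶ G) [Epi φ] (x : X) :
    Function.Surjective (stalkMap φ x) :=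
  (AddCommGrpCat.epi_iff_surjective ((stalkFunctor X x).map φ)).1 inferInstance

theorem stalkMap_exact {S : ShortComplex (SheafMod X)} (h : S.ShortExact) (x : X) :
    Function.Exact (stalkMap S.f x) (stalkMap S.g x) := by
  have := h.mono_f
  have := h.exact.map_of_mono_of_preservesKernel (stalkFunctor X x) inferInstance inferInstance
  exact (ShortComplex.ab_exact_iff_function_exact _).1 this

end KahlerSurface

/-! ### Finitely generated sheaves of modules -/

namespace SheafOfModules
open Limits
variable {C : Type*} [Category* C]
    {J : GrothendieckTopology C} {R : Sheaf J RingCat.{0}} [HasSheafify J AddCommGrpCat.{0}]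
    [J.WEqualsLocallyBijective AddCommGrpCat.{0}]

omit [HasSheafify J AddCommGrpCat.{0}] [J.WEqualsLocallyBijective AddCommGrpCat.{0}] in
theorem unitHom_apply {M : SheafOfModules.{0} R} (f : unit R ⟶ M) (X : Cᵒᵖ) (a : R.obj.obj X) :
    f.val.app X a = a • (M.unitHomEquiv f).eval X := by
  have h : a • (1 : R.obj.obj X) = a := by rw [smul_eq_mul, mul_one]
  exact (congrArg (f.val.app X) h).symm.trans ((f.val.app X).hom.map_smul a (1 : R.obj.obj X))

/-- Over every object, the image of a morphism from a finite free sheaf lies in the span of the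
sections that define the morphism: a finite coproduct of copies of the structure sheaf is also
their product, so the identity of `free I` is the sum of the compositions of projections and
inclusions. -/
theorem freeHom_mem_span {M : SheafOfModules.{0} R} {I : Type} [Finite I] (f : free I ⟶ M)
    (X : Cᵒᵖ) (t : (free (R := R) I).val.obj X) :
    f.val.app X t ∈
      Submodule.span (R.obj.obj X) (Set.range fun i => (M.freeHomEquiv f i).eval X) := by
  classical
  have := Fintype.ofFinite I
  let p (i : I) : free (R := R) I ⟶ unit R :=
    Cofan.IsColimit.desc (isColimitFreeCofan I) fun j => if j = i then 𝟙 _ else 0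
  have hp (i j : I) : ιFree j ≫ p i = if j = i then 𝟙 _ else 0 :=
    Cofan.IsColimit.fac (isColimitFreeCofan I) _ j
  have htot : ∑ i, p i ≫ ιFree i ≫ f = f := by
    refine Cofan.IsColimit.hom_ext (isColimitFreeCofan I) _ _ fun j => ?_
    change ιFree j ≫ (∑ i, p i ≫ ιFree i ≫ f) = ιFree j ≫ f
    rw [Preadditive.comp_sum, Finset.sum_eq_single j]
    · rw [← Category.assoc, hp, if_pos rfl, Category.id_comp]
    · intro i _ hij
      rw [← Category.assoc, hp, if_neg hij.symm, zero_comp]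
    · simp
  let ev : (free (R := R) I ⟶ M) →+ M.val.obj X :=
    AddMonoidHom.mk' (fun φ => φ.val.app X t) fun _ _ => rfl
  have happ : f.val.app X t = ∑ i, (ιFree i ≫ f).val.app X ((p i).val.app X t) :=
    (congrArg ev htot).symm.trans (map_sum ev _ _)
  rw [happ]
  refine Submodule.sum_mem _ fun i _ => ?_
  erw [unitHom_apply]
  exact Submodule.smul_mem _ _ (Submodule.subset_span ⟨i, rfl⟩)

/-- Every section of a sheaf of modules generated by finitely many sections is locally a linear
combination of them. -/
theorem GeneratingSections.locally_mem_span {M : SheafOfModules.{0} R} (G : M.GeneratingSections)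
    [Finite G.I] (U : C) (t : M.val.obj (op U)) :
    ∃ S ∈ J U, ∀ ⦃V : C⦄ (i : V ⟶ U), S i → M.val.map i.op t ∈
      Submodule.span (R.obj.obj (op V)) (Set.range fun a => (G.s a).eval (op V)) := by
  have := SheafOfModules.toSheaf_preservesEpimorphisms R
  have h : Sheaf.IsLocallySurjective ((toSheaf R).map G.π) :=
    (Sheaf.isLocallySurjective_iff_epi' _ _).2 inferInstance
  refine ⟨_, Presheaf.imageSieve_mem J ((toSheaf R).map G.π).hom t, fun V i hi => ?_⟩
  obtain ⟨u, hu⟩ := hi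
  have := freeHom_mem_span G.π (op V) u
  rw [Equiv.apply_symm_apply] at this
  exact Set.mem_of_eq_of_mem hu.symm this

end SheafOfModules

namespace KahlerSurface
variable {X : Type} [TopologicalSpace X] [ChartedSpace C2 X]

theorem IsVectorBundle.isCoherent {F : SheafMod X} {r : ℕ} (h : IsVectorBundle F r) :
    IsCoherent F := by
  obtain ⟨q, hq, hf⟩ := h
  exact ⟨q.quasiCoherentData, ⟨fun i => ⟨⟨(hf i).1⟩, ⟨inferInstanceAs (Finite (ULift Empty))⟩⟩⟩⟩

/-- The germ at `x` of a section over `U`. -/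
def germ (F : SheafMod X) (U : Opens X) (x : X) (hx : x ∈ U) : Sec F U →+ Stalk F x :=
  (TopCat.Presheaf.germ (PresheafOfModules.presheaf
    (R := (holSheaf X).presheaf ⋙ forget₂ CommRingCat.{0} RingCat.{0}) F.val) U x hx).hom

theorem germ_smul (F : SheafMod X) (U : Opens X) (x : X) (hx : x ∈ U) (f : Hol U) (s : Sec F U) :
    germ F U x hx (f • s) = (holSheaf X).presheaf.germ U x hx f • germ F U x hx s :=
  PresheafOfModules.germ_smul (R := (holSheaf X).presheaf) F.val x U hx f s

theorem germ_res (F : SheafMod X) {U W : Opens X} (h : W ≤ U) (x : X) (hx : x ∈ W) (s : Sec F U) :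
    germ F W x hx (res F h s) = germ F U x (h hx) s :=
  TopCat.Presheaf.germ_res_apply (PresheafOfModules.presheaf
    (R := (holSheaf X).presheaf ⋙ forget₂ CommRingCat.{0} RingCat.{0}) F.val) (homOfLE h) x hx s

theorem exists_germ_eq (F : SheafMod X) {U : Opens X} {x : X} (hx : x ∈ U) (t : Stalk F x) :
    ∃ (V : Opens X) (_ : V ≤ U) (hV : x ∈ V) (s : Sec F V), germ F V x hV s = t := by
  obtain ⟨V, h, hV, s, hs⟩ := TopCat.Presheaf.exists_le_germ_eq (PresheafOfModules.presheaf
    (R := (holSheaf X).presheaf ⋙ forget₂ CommRingCat.{0} RingCat.{0}) F.val) t hx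
  exact ⟨V, h, hV, s, hs⟩

/-- The stalks of a vector bundle are finitely generated, by the germs of local generators. -/
theorem IsVectorBundle.finite_stalk {F : SheafMod X} {r : ℕ} (h : IsVectorBundle F r) (x : X) :
    Module.Finite ((holSheaf X).presheaf.stalk x) (Stalk F x) := by
  obtain ⟨q, hq, hf⟩ := h
  obtain ⟨V, _, ⟨i, ⟨hV⟩⟩, hxV⟩ := q.coversTop ⊤ x trivial
  have hxi : x ∈ q.X i := hV.le hxV
  have := (hf i).1
  -- The generators are sections on the slice over `q.X i`; `g` gives them as sections over `q.X i`.
  let g (a : (q.generators i).I) : Sec F (q.X i) :=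
    ((q.generators i).s a).eval (op (Over.mk (𝟙 (q.X i))))
  have hg (W : Opens X) (hW : W ≤ q.X i) (a : (q.generators i).I) :
      ((q.generators i).s a).eval (op (Over.mk (homOfLE hW))) = res F hW (g a) :=
    (((q.generators i).s a).2
      (Over.homMk (homOfLE hW) : Over.mk (homOfLE hW) ⟶ Over.mk (𝟙 (q.X i))).op).symm
  refine Module.Finite.of_fg_top (Submodule.fg_def.2
    ⟨Set.range fun a => germ F (q.X i) x hxi (g a), Set.finite_range _, ?_⟩)
  rw [eq_top_iff]
  rintro t -
  obtain ⟨W, hW, hxW, s, rfl⟩ := exists_germ_eq F hxi t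
  obtain ⟨S, hS, h⟩ := (q.generators i).locally_mem_span (Over.mk (homOfLE hW)) s
  rw [GrothendieckTopology.mem_over_iff] at hS
  obtain ⟨W', k, hk, hxW'⟩ := hS x hxW
  have hspan : res F k.le s ∈
      Submodule.span (Hol W') (Set.range fun a => res F (k.le.trans hW) (g a)) := by
    have h' := h (Over.homMk k : Over.mk (k ≫ (Over.mk (homOfLE hW)).hom) ⟶ Over.mk (homOfLE hW))
      ((Sieve.overEquiv_iff _ _).1 hk)
    have e := funext (hg W' (k.le.trans hW))
    rw [← e]
    exact h'
  have hkW : W' ≤ W := k.le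
  rw [← germ_res F hkW x hxW' s]
  refine Submodule.span_induction (p := fun m _ => germ F W' x hxW' m ∈ _) ?_ ?_ ?_ ?_ hspan
  · rintro _ ⟨a, rfl⟩
    rw [germ_res]
    exact Submodule.subset_span ⟨a, rfl⟩
  · rw [map_zero]
    exact Submodule.zero_mem _
  · intro m n _ _ hm hn
    rw [map_add]
    exact Submodule.add_mem _ hm hn
  · intro c m _ hm
    rw [germ_smul]
    exact Submodule.smul_mem _ _ hm
end KahlerSurface

namespace KahlerSurface
variable {X : Type} [TopologicalSpace X] [ChartedSpace C2 X] [IsManifold 𝓘(ℂ, C2) ∞ X]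

/-! ### Additivity of the rank and of the Chern character -/

/-- Additivity of the rank on a short exact sequence, over the integral domain of germs. The middle
term is assumed to be a vector bundle for its stalks to have finite rank. -/
theorem finrank_stalk_add {S : ShortComplex (SheafMod X)} (h : S.ShortExact) {r : ℕ}
    (hE : IsVectorBundle S.X₂ r) (x : X) :
    Module.finrank ((holSheaf X).presheaf.stalk x) (Stalk S.X₂ x) =
      Module.finrank ((holSheaf X).presheaf.stalk x) (Stalk S.X₁ x) +
        Module.finrank ((holSheaf X).presheaf.stalk x) (Stalk S.X₃ x) := by
  have := h.mono_f
  have := h.epi_g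
  have := hE.finite_stalk x
  have e1 := (LinearEquiv.ofInjective _ (stalkMap_injective S.f x)).finrank_eq
  have e2 := ((stalkMap S.g x).quotKerEquivOfSurjective (stalkMap_surjective S.g x)).finrank_eq
  have e3 := Submodule.finrank_quotient_add_finrank (LinearMap.ker (stalkMap S.g x))
  rw [LinearMap.exact_iff.1 (stalkMap_exact h x)] at e3 e2
  omega

theorem rank_add [ConnectedSpace X] {S : ShortComplex (SheafMod X)} (h : S.ShortExact) {r : ℕ}
    (hE : IsVectorBundle S.X₂ r) : rank S.X₂ = rank S.X₁ + rank S.X₃ :=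
  finrank_stalk_add h hE _

omit [IsManifold 𝓘(ℂ, C2) ∞ X] in
theorem finrank_stalk_le_of_mono {S E : SheafMod X} (i : S ⟶ E) [Mono i] {r : ℕ}
    (hE : IsVectorBundle E r) (x : X) :
    Module.finrank ((holSheaf X).presheaf.stalk x) (Stalk S x) ≤
      Module.finrank ((holSheaf X).presheaf.stalk x) (Stalk E x) :=
  have := hE.finite_stalk x
  LinearMap.finrank_le_finrank_of_injective (stalkMap_injective i x)

omit [IsManifold 𝓘(ℂ, C2) ∞ X] in
theorem rank_le_of_mono [ConnectedSpace X] {S E : SheafMod X} (i : S ⟶ E) [Mono i] {r : ℕ}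
    (hE : IsVectorBundle E r) : rank S ≤ rank E :=
  finrank_stalk_le_of_mono i hE _

variable [T2Space X] [CompactSpace X]

/-- If no Chern character exists then `chernCharacter` is zero, which is additive too. -/
theorem chernCharacter_add {S : ShortComplex (SheafMod X)} (h : S.ShortExact)
    (h₁ : IsCoherent S.X₁) (h₂ : IsCoherent S.X₂) (h₃ : IsCoherent S.X₃) :
    chernCharacter S.X₂ = chernCharacter S.X₁ + chernCharacter S.X₃ := by
  unfold chernCharacter
  split_ifs with hc
  · exact hc.choose_spec.1 S h h₁ h₂ h₃
  · simp

theorem pairing_comm (a b : H2 X) : pairing X a b = pairing X b a := by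
  obtain ⟨a, rfl⟩ := (exactForms X).mkQ_surjective a
  obtain ⟨b, rfl⟩ := (exactForms X).mkQ_surjective b
  exact pairForms_comm a b

/-! ### The central charge and the twisted slope -/

variable [ConnectedSpace X] (Z : CentralCharge X)

namespace CentralCharge

/-- The imaginary part of the coefficient of `rk F` in `exp(-i ϑ_E) Z_X(F)`. -/
def rankCoeff (E : SheafMod X) : ℝ :=
  (Z.phase E * (Z.ρ 0 * integral Z.u₂.1 + Z.ρ 1 * pairing X Z.uClass Z.kahlerClass
      + Z.ρ 2 * pairing X Z.kahlerClass Z.kahlerClass)).im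

theorem two_alpha_mul_pairing_twist {E : SheafMod X} (hα : Z.alpha E ≠ 0) (c : H2 X) :
    2 * Z.alpha E * pairing X c (Z.twist E) = (Z.phase E * Z.ρ 0).im * pairing X Z.uClass c
      + (Z.phase E * Z.ρ 1).im * pairing X Z.kahlerClass c := by
  have h : Z.twist E = (1 / (2 * Z.alpha E)) • ((Z.phase E * Z.ρ 0).im • Z.uClass
      + (Z.phase E * Z.ρ 1).im • Z.kahlerClass) := by
    simp only [twist, beta, uClass, kahlerClass, map_smul, map_add]
  rw [h, map_smul, map_add, map_smul, map_smul, pairing_comm c, pairing_comm c]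
  simp only [smul_eq_mul]
  field_simp

theorem phase_mul_charge_im {E : SheafMod X} (hα : Z.alpha E ≠ 0) (F : SheafMod X) :
    (Z.phase E * Z.charge F).im = Z.rankCoeff E * rank F
      + 2 * Z.alpha E * (ch2 F + pairing X (ch1 F) (Z.twist E)) := by
  have h : 2 * Z.alpha E = (Z.phase E * Z.ρ 0).im := by simp only [alpha]; ring
  rw [mul_add, two_alpha_mul_pairing_twist Z hα, h]
  simp only [charge, rankCoeff, Complex.add_im, Complex.mul_im, Complex.ofReal_re,
    Complex.ofReal_im, Complex.add_re, Complex.mul_re, Complex.natCast_re, Complex.natCast_im]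
  ring

theorem conj_charge (E : SheafMod X) :
    (starRingEnd ℂ) (Z.charge E) = ‖Z.charge E‖ * Z.phase E := by
  conv_lhs => rw [← Complex.norm_mul_exp_arg_mul_I (Z.charge E)]
  rw [map_mul, Complex.conj_ofReal, ← Complex.exp_conj, map_mul, Complex.conj_ofReal,
    Complex.conj_I, phase]
  congr 2
  ring

theorem charge_mul_conj_im {E : SheafMod X} (hα : Z.alpha E ≠ 0) (F : SheafMod X) :
    (Z.charge F * (starRingEnd ℂ) (Z.charge E)).im = ‖Z.charge E‖ * (Z.rankCoeff E * rank F
      + 2 * Z.alpha E * (ch2 F + pairing X (ch1 F) (Z.twist E))) := by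
  rw [conj_charge, ← phase_mul_charge_im Z hα, ← Complex.im_ofReal_mul]
  congr 1
  ring

/-- `Z_X(E) * conj Z_X(E)` is real, which determines the coefficient of the rank. -/
theorem rankCoeff_eq {E : SheafMod X} (hZ : Z.charge E ≠ 0) (hα : Z.alpha E ≠ 0)
    (hr : 0 < rank E) : Z.rankCoeff E = -(2 * Z.alpha E * slopeMA (Z.twist E) E) := by
  have h := charge_mul_conj_im Z hα E
  rw [Complex.mul_conj, Complex.ofReal_im, eq_comm, mul_eq_zero,
    or_iff_right (norm_ne_zero_iff.2 hZ)] at h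
  have hr' : (rank E : ℝ) ≠ 0 := by positivity
  rw [slopeMA]
  field_simp
  linarith

theorem charge_mul_conj_im_eq_slope {E S : SheafMod X} (hZ : Z.charge E ≠ 0)
    (hα : Z.alpha E ≠ 0) (hE : 0 < rank E) (hS : 0 < rank S) :
    (Z.charge S * (starRingEnd ℂ) (Z.charge E)).im
      = 2 * Z.alpha E * rank S * ‖Z.charge E‖
        * (slopeMA (Z.twist E) S - slopeMA (Z.twist E) E) := by
  have hS' : (rank S : ℝ) ≠ 0 := by positivity
  rw [charge_mul_conj_im Z hα, rankCoeff_eq Z hZ hα hE, slopeMA.eq_def _ S]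
  field_simp
  ring

theorem charge_add {S : ShortComplex (SheafMod X)} (h : S.ShortExact) (h₁ : IsCoherent S.X₁)
    (h₃ : IsCoherent S.X₃) {r : ℕ} (hE : IsVectorBundle S.X₂ r) :
    Z.charge S.X₂ = Z.charge S.X₁ + Z.charge S.X₃ := by
  have hc := chernCharacter_add h h₁ hE.isCoherent h₃
  simp only [charge, ch1, ch2, hc, rank_add h hE, Prod.fst_add, Prod.snd_add, map_add]
  push_cast
  ring

/-- As `Z_X(Q) / Z_X(E) = 1 - Z_X(S) / Z_X(E)`, the phase condition on the quotient `Q` is the slope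
condition on the subobject `S`. -/
theorem quotient_im_pos_iff {S E Q : SheafMod X} (hc : Z.charge E = Z.charge S + Z.charge Q)
    (hZ : Z.charge E ≠ 0) (hα : 0 < Z.alpha E) (hS : 0 < rank S) (hE : 0 < rank E) :
    0 < (Z.charge Q / Z.charge E).im ↔ slopeMA (Z.twist E) S < slopeMA (Z.twist E) E := by
  have hs := charge_mul_conj_im_eq_slope Z hZ hα.ne' hE hS
  have hq : Z.charge Q = Z.charge E - Z.charge S := by
    rw [hc]; ring
  have hn : 0 < ‖Z.charge E‖ := norm_pos_iff.2 hZ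
  have hdiv : (Z.charge Q / Z.charge E).im =
      2 * Z.alpha E * rank S / ‖Z.charge E‖
        * (slopeMA (Z.twist E) E - slopeMA (Z.twist E) S) := by
    have e : (Z.charge Q / Z.charge E).im
        = -((Z.charge S * (starRingEnd ℂ) (Z.charge E)).im / ‖Z.charge E‖ ^ 2) := by
      rw [hq, sub_div, div_self hZ, Complex.sub_im, Complex.one_im, zero_sub, div_eq_mul_inv,
        Complex.inv_def, ← mul_assoc, Complex.normSq_eq_norm_sq, Complex.im_mul_ofReal,
        div_eq_mul_inv]
    rw [e, hs]
    field_simp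
    ring
  have hS' : (0 : ℝ) < rank S := by exact_mod_cast hS
  rw [hdiv, mul_pos_iff_of_pos_left (by positivity), sub_pos]

end CentralCharge

theorem zStable_iff_maStable {E : SheafMod X} {r : ℕ} (hE : IsVectorBundle E r)
    (hZ : Z.charge E ≠ 0) (hα : 0 < Z.alpha E) : ZStable Z E ↔ MAStable (Z.twist E) E := by
  have key (S Q : SheafMod X) (i : S ⟶ E) (p : E ⟶ Q) (w : i ≫ p = 0)
      (hex : (ShortComplex.mk i p w).ShortExact) (hS : IsCoherent S) (hQ : IsCoherent Q) :
      rank E = rank S + rank Q ∧ Z.charge E = Z.charge S + Z.charge Q :=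
    ⟨rank_add (S := .mk i p w) hex hE, Z.charge_add (S := .mk i p w) hex hS hQ hE⟩
  constructor
  · intro H S Q i p w hex hS hQ hT h0 h1
    obtain ⟨hr, hc⟩ := key S Q i p w hex hS hQ
    exact (Z.quotient_im_pos_iff hc hZ hα h0 (h0.trans h1)).1
      (H S Q i p w hex hS hQ hT (by omega) (by omega))
  · intro H S Q i p w hex hS hQ hT h0 h1
    obtain ⟨hr, hc⟩ := key S Q i p w hex hS hQ
    exact (Z.quotient_im_pos_iff hc hZ hα (by omega) (h0.trans h1)).2
      (H S Q i p w hex hS hQ hT (by omega) (by omega))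

end KahlerSurface

end

theorem mainTheorem4 {X : Type} [TopologicalSpace X] [T2Space X] [CompactSpace X]
    [ConnectedSpace X] [ChartedSpace KahlerSurface.C2 X]
    [IsManifold 𝓘(ℂ, KahlerSurface.C2) ∞ X]
    (Z : KahlerSurface.CentralCharge X) (E : KahlerSurface.SheafMod X) (r : ℕ)
    (hE : KahlerSurface.IsVectorBundle E r) (hZ : Z.charge E ≠ 0) :
    (Z.alpha E ≠ 0 → ∀ (S : KahlerSurface.SheafMod X) (i : S ⟶ E), Mono i →
      KahlerSurface.IsCoherent S → 0 < KahlerSurface.rank S →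
        (Z.charge S * (starRingEnd ℂ) (Z.charge E)).im
          = 2 * Z.alpha E * KahlerSurface.rank S * ‖Z.charge E‖
            * (KahlerSurface.slopeMA (Z.twist E) S - KahlerSurface.slopeMA (Z.twist E) E)) ∧
    (0 < Z.alpha E →
      (KahlerSurface.ZStable Z E ↔ KahlerSurface.MAStable (Z.twist E) E)) := by
  exact ⟨fun hα S i _ _ hS => Z.charge_mul_conj_im_eq_slope hZ hα
    (hS.trans_le (KahlerSurface.rank_le_of_mono i hE)) hS,
    fun hα => KahlerSurface.zStable_iff_maStable Z hE hZ hα⟩
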